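/- Let $n\ge 1$ and let $M$ be a smooth $4n$-dimensional manifold with an almost quaternionic structure $\mathcal Q$, i.e. a subbundle $\mathcal Q\subset \mathrm{End}(TM)$ which is locally spanned by smooth triples $J_1,J_2,J_3$ with $J_a^2=-\mathrm{id}$ and $J_1J_2=-J_2J_1=J_3$ (admissible local bases). A quaternionic connection is a smooth linear connection $\nabla$ on $TM$ such that, for every admissible local basis, there are local 1-forms $\omega_1,\omega_2,\omega_3$ with $\nabla J_a=-\omega_b\otimes J_c+\omega_c\otimes J_b$ for all cyclic permutations $(a,b,c)$ of $(1,2,3)$. Let $J^0_1,J^0_2,J^0_3$ be the endomorphisms $J^0_a v=-v\,j_a$ of $\mathbb H^n=\mathbb R^{4n}$, where $j_1,j_2,j_3$ are the imaginary unit quaternions, let $sp(1)=\mathrm{span}\{J^0_1,J^0_2,J^0_3\}$, let $gl(n,\mathbb H)$ be the commutant of $sp(1)$ in $gl(4n,\mathbb R)$, and let $m_3=\{A\in gl(n,\mathbb H)\oplus sp(1): AJ^0_3=-J^0_3A\}$. Let $\mathcal Q(M)$ be the bundle of linear frames $u:\mathbb H^n\to T_xM$ with $u\,sp(1)\,u^{-1}=\mathcal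 Q_x$, put $j(u)=uJ^0_3u^{-1}$, and let $Z=j(\mathcal Q(M))\subset\mathrm{End}(TM)$ be the twistor space. For a quaternionic connection $\nabla$, the almost complex structure $I_1^\nabla$ on $Z$ is defined by $$I_1^\nabla(j_{*u}A^*)=j_{*u}(J^0_3A)^*,\qquad I_1^\nabla(j_{*u}B(\xi))=j_{*u}B(J^0_3\xi)\qquad (u\in \mathcal Q(M),\ A\in m_3,\ \xi\in\mathbb H^n),$$ where $A^*$ is the fundamental vector field of $A$ and $B(\xi)$ is the standard horizontal vector field of $\nabla$, i.e. $B(\xi)_u$ is the $\nabla$-horizontal vector at $u$ lying over $u(\xi)$. Let $\nabla$ and $\nabla'$ be quaternionic connections on $(M,\mathcal Q)$ and write $\nabla'_X=\nabla_X+S_X$. Then for every admissible local basis $J_1,J_2,J_3$ there are local 1-forms $s^1,s^2,s^3$ (the $sp(1)$-components of $S$) such that $$S_XY=S^0_XY+s^1(X)J_1Y+s^2(X)J_2Y+s^3(X)J_3Y,\qquad [S^0_X,J_a]=0\quad(a=1,2,3),$$ and the following conditions are equivalent: (i) the almost complex structures $I_1^{\nabla}$ and $I_1^{\nabla'}$ on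 $Z$ coincide; (ii) for every admissible local basis, $s^1(J_1X)=s^2(J_2X)=s^3(J_3X)$ for all tangent vectors $X$. -/

import Mathlib

open Bundle Set Topology
open scoped Manifold ContDiff Quaternion

noncomputable section

namespace Twistor

/-! ### The linear model -/

/-- The real vector space `ℍⁿ ≅ ℝ⁴ⁿ`. -/
def QuatSpace (n : ℕ) : Type := Fin n → ℍ[ℝ]

instance (n : ℕ) : NormedAddCommGroup (QuatSpace n) :=
  inferInstanceAs (NormedAddCommGroup (Fin n → ℍ[ℝ]))

instance (n : ℕ) : NormedSpace ℝ (QuatSpace n) :=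
  inferInstanceAs (NormedSpace ℝ (Fin n → ℍ[ℝ]))

instance (n : ℕ) : FiniteDimensional ℝ (QuatSpace n) :=
  inferInstanceAs (FiniteDimensional ℝ (Fin n → ℍ[ℝ]))

/-- The imaginary unit quaternions `j₁ = i`, `j₂ = j`, `j₃ = k`. -/
def quatUnit : Fin 3 → ℍ[ℝ] := ![⟨0, 1, 0, 0⟩, ⟨0, 0, 1, 0⟩, ⟨0, 0, 0, 1⟩]

/-- The model endomorphisms `J⁰ₐ v = - v jₐ` of `ℍⁿ` (minus right multiplication by `jₐ`); they
satisfy `J⁰₁ J⁰₂ = - J⁰₂ J⁰₁ = J⁰₃`. -/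
def J0 (n : ℕ) (a : Fin 3) : QuatSpace n →L[ℝ] QuatSpace n :=
  LinearMap.toContinuousLinearMap
    { toFun := fun v k => -(v k * quatUnit a)
      map_add' := fun v w => funext fun k => by
        change -((v k + w k) * quatUnit a) = -(v k * quatUnit a) + -(w k * quatUnit a)
        rw [add_mul, neg_add]
      map_smul' := fun r v => funext fun k => by
        change -((r • v k) * quatUnit a) = r • -(v k * quatUnit a)
        rw [smul_mul_assoc, smul_neg] }

/-- `sp(1) = span {J⁰₁, J⁰₂, J⁰₃}`. -/
def sp1 (n : ℕ) : Submodule ℝ (QuatSpace n →L[ℝ] QuatSpace n) :=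
  Submodule.span ℝ (range (J0 n))

/-- `gl(n, ℍ)`: the real endomorphisms of `ℍⁿ` commuting with all of `sp(1)`. -/
def glH (n : ℕ) : Submodule ℝ (QuatSpace n →L[ℝ] QuatSpace n) where
  carrier := {A | ∀ B ∈ sp1 n, A ∘L B = B ∘L A}
  add_mem' := by
    intro A A' h h' B hB
    simp [ContinuousLinearMap.add_comp, ContinuousLinearMap.comp_add, h B hB, h' B hB]
  zero_mem' := by intro B _; simp
  smul_mem' := by
    intro r A h B hB
    simp [ContinuousLinearMap.smul_comp, h B hB]

/-- `m₃ = {A ∈ gl(n, ℍ) ⊕ sp(1) | A J⁰₃ = - J⁰₃ A}`. -/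
def m3 (n : ℕ) : Set (QuatSpace n →L[ℝ] QuatSpace n) :=
  {A | A ∈ glH n ⊔ sp1 n ∧ A ∘L J0 n 2 = -(J0 n 2 ∘L A)}

/-! ### Bundles over a manifold `M` modelled on `E` -/

section

variable (E : Type*) [NormedAddCommGroup E] [NormedSpace ℝ E]
  (M : Type*) [TopologicalSpace M] [ChartedSpace E M]

/-- The fibre `End(T_x M)`. -/
abbrev EndFiber (x : M) : Type _ := TangentSpace 𝓘(ℝ, E) x →L[ℝ] TangentSpace 𝓘(ℝ, E) x

/-- The fibre `Hom(ℍⁿ, T_x M)`; the linear frames at `x` are its invertible elements. -/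
abbrev FrameFiber (n : ℕ) (x : M) : Type _ :=
  Trivial M (QuatSpace n) x →L[ℝ] TangentSpace 𝓘(ℝ, E) x

variable [IsManifold 𝓘(ℝ, E) ∞ M]

/-- The total space of the vector bundle `End(TM)`. -/
abbrev EndBundle : Type _ := TotalSpace (E →L[ℝ] E) (EndFiber E M)

/-- The total space of the vector bundle `Hom(ℍⁿ, TM)`, which contains the bundle of linear frames
of `M` as an open subset. -/
abbrev FrameBundle (n : ℕ) : Type _ := TotalSpace (QuatSpace n →L[ℝ] E) (FrameFiber E M n)

/-- The model with corners of the manifold `End(TM)`. -/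
abbrev endModel : ModelWithCorners ℝ (E × (E →L[ℝ] E)) (ModelProd E (E →L[ℝ] E)) :=
  𝓘(ℝ, E).prod 𝓘(ℝ, E →L[ℝ] E)

/-- The model with corners of the manifold `Hom(ℍⁿ, TM)`. -/
abbrev frameModel (n : ℕ) :
    ModelWithCorners ℝ (E × (QuatSpace n →L[ℝ] E)) (ModelProd E (QuatSpace n →L[ℝ] E)) :=
  𝓘(ℝ, E).prod 𝓘(ℝ, QuatSpace n →L[ℝ] E)

end

section

variable {E : Type*} [NormedAddCommGroup E] [NormedSpace ℝ E]
  {M : Type*} [TopologicalSpace M] [ChartedSpace E M] [IsManifold 𝓘(ℝ, E) ∞ M]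

/-! ### Almost quaternionic structures and quaternionic connections -/

/-- `J₁, J₂, J₃` is an admissible basis on the open set `U` of the family `Q` of subspaces of
`End(T_x M)`: a smooth almost hypercomplex structure on `U` which spans `Q` there. -/
structure IsAdmissibleBasis (Q : ∀ x : M, Submodule ℝ (EndFiber E M x)) (U : Set M)
    (J : Fin 3 → ∀ x : M, EndFiber E M x) : Prop where
  isOpen : IsOpen U
  smooth : ∀ a, ContMDiffOn 𝓘(ℝ, E) (endModel E) ∞ (fun x => (⟨x, J a x⟩ : EndBundle E M)) U
  sq : ∀ x ∈ U, ∀ a, J a x ∘L J a x = -ContinuousLinearMap.id ℝ (TangentSpace 𝓘(ℝ, E) x)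
  mul : ∀ x ∈ U, J 0 x ∘L J 1 x = J 2 x
  mul_rev : ∀ x ∈ U, J 1 x ∘L J 0 x = -J 2 x
  span : ∀ x ∈ U, Q x = Submodule.span ℝ (range fun a => J a x)

variable (E M) in
/-- An almost quaternionic structure: a subbundle of `End(TM)` which is locally spanned by an
almost hypercomplex structure. -/
structure AlmostQuaternionicStructure where
  fiber : ∀ x : M, Submodule ℝ (EndFiber E M x)
  exists_basis : ∀ x : M, ∃ (U : Set M) (J : Fin 3 → ∀ x : M, EndFiber E M x),
    x ∈ U ∧ IsAdmissibleBasis fiber U J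

variable (E M) in
/-- Linear connections on `M`, i.e. covariant derivatives on `TM`; `D Y x X` is `(∇_X Y)(x)`. -/
abbrev LinearConnection : Type _ :=
  CovariantDerivative 𝓘(ℝ, E) E (TangentSpace 𝓘(ℝ, E) : M → Type _)

/-- A smooth linear connection is quaternionic if for every admissible local basis there are local
1-forms `θ₁, θ₂, θ₃` with `∇Jₐ = - θ_b ⊗ J_c + θ_c ⊗ J_b` for all cyclic permutations `(a, b, c)`,
where `(∇_X Jₐ) Y = ∇_X (Jₐ Y) - Jₐ (∇_X Y)`. -/
structure IsQuaternionic (Q : AlmostQuaternionicStructure E M) (D : LinearConnection E M) :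
    Prop where
  smooth : CovariantDerivative.ContMDiffCovariantDerivative D ∞
  parallel : ∀ (U : Set M) (J : Fin 3 → ∀ x : M, EndFiber E M x),
    IsAdmissibleBasis Q.fiber U J →
    ∃ θ : Fin 3 → ∀ x : M, TangentSpace 𝓘(ℝ, E) x →L[ℝ] ℝ,
      ∀ x ∈ U, ∀ Y : ∀ y : M, TangentSpace 𝓘(ℝ, E) y,
        MDifferentiableAt 𝓘(ℝ, E) 𝓘(ℝ, E).tangent (fun y => (⟨y, Y y⟩ : TangentBundle 𝓘(ℝ, E) M)) x →
        ∀ (X : TangentSpace 𝓘(ℝ, E) x) (a : Fin 3),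
          D (fun y => J a y (Y y)) x X - J a x (D Y x X)
            = -(θ (a + 1) x X • J (a + 2) x (Y x)) + θ (a + 2) x X • J (a + 1) x (Y x)

/-- The 1-forms `s¹, s², s³` are the `sp(1)`-components on `U`, with respect to `J₁, J₂, J₃`, of the
tensor `S = ∇' - ∇`: one has `S_X Y = S⁰_X Y + ∑ₐ sᵃ(X) Jₐ Y` with `[S⁰_X, Jₐ] = 0`. -/
def IsSp1Components [FiniteDimensional ℝ E] (D D' : LinearConnection E M) (U : Set M)
    (J : Fin 3 → ∀ x : M, EndFiber E M x)
    (s : Fin 3 → ∀ x : M, TangentSpace 𝓘(ℝ, E) x →L[ℝ] ℝ) : Prop :=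
  ∀ x ∈ U, ∃ S0 : TangentSpace 𝓘(ℝ, E) x →L[ℝ] EndFiber E M x,
    (∀ X a, S0 X ∘L J a x = J a x ∘L S0 X) ∧
    ∀ X Y : TangentSpace 𝓘(ℝ, E) x,
      D'.difference D x Y X = S0 X Y + ∑ a, s a x X • J a x Y

/-! ### The principal bundle `Q(M)` and the twistor space -/

/-- `Q(M)`: the linear frames `u : ℍⁿ → T_x M` such that `u sp(1) u⁻¹ = Q_x`. -/
def quatFrames (n : ℕ) (Q : AlmostQuaternionicStructure E M) : Set (FrameBundle E M n) :=
  {u | u.2.IsInvertible ∧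
    (Q.fiber u.1 : Set (EndFiber E M u.1)) = (fun B => u.2 ∘L B ∘L u.2.inverse) '' (sp1 n)}

/-- The map `j(u) = u J⁰₃ u⁻¹`. -/
def jMap (n : ℕ) (u : FrameBundle E M n) : EndBundle E M :=
  ⟨u.1, u.2 ∘L J0 n 2 ∘L u.2.inverse⟩

/-- The twistor space `Z = j(Q(M))`, a submanifold of `End(TM)`. -/
def twistorSpace (n : ℕ) (Q : AlmostQuaternionicStructure E M) : Set (EndBundle E M) :=
  jMap n '' quatFrames n Q

/-- The tangent bundle `TZ`: the velocities of smooth curves in the twistor space. -/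
def tangentTwistorSpace (n : ℕ) (Q : AlmostQuaternionicStructure E M) :
    Set (TangentBundle (endModel E) (EndBundle E M)) :=
  {W | ∃ (γ : ℝ → EndBundle E M) (ε : ℝ), 0 < ε ∧
    ContMDiffOn 𝓘(ℝ, ℝ) (endModel E) ∞ γ (Ioo (-ε) ε) ∧
    (∀ t ∈ Ioo (-ε) ε, γ t ∈ twistorSpace n Q) ∧
    W = tangentMap 𝓘(ℝ, ℝ) (endModel E) γ ⟨0, (1 : ℝ)⟩}

/-! ### Fundamental and standard horizontal vectors, and the structure `I₁` -/

/-- The fundamental vector `A*_u`: the velocity at `t = 0` of the curve `t ↦ u exp(tA)`. -/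
def fundamentalVector {n : ℕ} (A : QuatSpace n →L[ℝ] QuatSpace n) (u : FrameBundle E M n) :
    TangentSpace (frameModel E n) u :=
  mfderiv 𝓘(ℝ, ℝ) (frameModel E n)
    (fun t : ℝ => (⟨u.1, u.2 ∘L (NormedSpace.exp (t • A) : QuatSpace n →L[ℝ] QuatSpace n)⟩ : FrameBundle E M n)) 0 (1 : ℝ)

/-- The horizontal subspace at the frame `u` induced by `∇`: the vectors `s_*(X)`, where `s` is a
local field of frames with `s(x) = u` whose members `s(e)` all satisfy `∇_X s(e) = 0` at `x`. -/
def horizontalSpace {n : ℕ} (D : LinearConnection E M) (u : FrameBundle E M n) :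
    Set (TangentSpace (frameModel E n) u) :=
  {V | ∃ (s : ∀ y : M, FrameFiber E M n y) (X : TangentSpace 𝓘(ℝ, E) u.1),
    MDifferentiableAt 𝓘(ℝ, E) (frameModel E n) (fun y => (⟨y, s y⟩ : FrameBundle E M n)) u.1 ∧
    (∀ e : QuatSpace n, D (fun y => s y e) u.1 X = 0) ∧
    (⟨u, V⟩ : TangentBundle (frameModel E n) (FrameBundle E M n)) =
      tangentMap 𝓘(ℝ, E) (frameModel E n) (fun y => (⟨y, s y⟩ : FrameBundle E M n)) ⟨u.1, X⟩}

/-- `V` is the standard horizontal vector `B(ξ)_u`: the horizontal vector at `u` lying over the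
tangent vector `u(ξ)` of `M`. -/
def IsStandardHorizontal {n : ℕ} (D : LinearConnection E M) (ξ : QuatSpace n)
    (u : FrameBundle E M n) (V : TangentSpace (frameModel E n) u) : Prop :=
  V ∈ horizontalSpace D u ∧
    mfderiv (frameModel E n) 𝓘(ℝ, E) (fun v : FrameBundle E M n => v.1) u V = u.2 ξ

/-- The graph of `I₁`: `W = j_*(A*_u + B(ξ)_u)` and `W' = j_*((J⁰₃ A)*_u + B(J⁰₃ ξ)_u)` for some
`u ∈ Q(M)`, `A ∈ m₃` and `ξ ∈ ℍⁿ`. -/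
def I1Graph (n : ℕ) (Q : AlmostQuaternionicStructure E M) (D : LinearConnection E M)
    (W W' : TangentBundle (endModel E) (EndBundle E M)) : Prop :=
  ∃ u ∈ quatFrames n Q, ∃ A ∈ m3 n, ∃ (ξ : QuatSpace n) (B B' : TangentSpace (frameModel E n) u),
    IsStandardHorizontal D ξ u B ∧ IsStandardHorizontal D (J0 n 2 ξ) u B' ∧
    W = tangentMap (frameModel E n) (endModel E) (jMap n) ⟨u, fundamentalVector A u + B⟩ ∧
    W' = tangentMap (frameModel E n) (endModel E) (jMap n)
      ⟨u, fundamentalVector (J0 n 2 ∘L A) u + B'⟩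

open Classical in
/-- The almost complex structure `I₁^∇`, as a map on `TZ` (with an irrelevant value outside `TZ`):
`I₁ (j_* A*) = j_* (J⁰₃ A)*` and `I₁ (j_* B(ξ)) = j_* B(J⁰₃ ξ)`. -/
def I1 (n : ℕ) (Q : AlmostQuaternionicStructure E M) (D : LinearConnection E M)
    (W : TangentBundle (endModel E) (EndBundle E M)) :
    TangentBundle (endModel E) (EndBundle E M) :=
  if h : ∃ W', I1Graph n Q D W W' then h.choose else W

end

end Twistor

end

/-! Write J₁, J₂, J₃ for the Lean indices 0, 1, 2, let Γ be the Christoffel symbols of a connection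
∇ in the trivialization at x, and let p ∈ Z lie over x. In that trivialization a vector tangent to
End(TM) at p is a pair (X, V), and its vertical part with respect to ∇ is V + [Γ(X), p].

Differentiating j(u) = u J⁰₃ u⁻¹ shows that j_*(A* + B(ξ)) lies over uξ and has vertical part u[A,
J⁰₃]u⁻¹. Since [J⁰₃A, J⁰₃] = J⁰₃[A, J⁰₃], the structure I₁ multiplies both the projection to M and
the vertical part by p. This formula, `twist`, involves no u, A or ξ, so I₁ is well defined. It
applies to every vector tangent to Z: ∇ preserves Q, so the vertical part lies in Q_x. It
anticommutes with p because p² = -1 along curves in Z. Such an endomorphism is u[A, J⁰₃]u⁻¹ for some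
A ∈ m₃ (`vertPart_mem_and_anticomm`, `I1_apply`).

Comparing the formulas for ∇ and ∇', with S = ∇' - ∇, the two structures agree on a vector at p over
X exactly when p[S_X, p] = [S_{pX}, p] (`twist_eq_twist_iff`). The part S⁰ drops out, because p lies
in the span of the Jₐ. At p = J₃ what remains is s¹(X) = s²(J₃X) and s²(X) = -s¹(J₃X). Putting J₁X
for X gives s¹(J₁X) = s²(J₂X), and cyclic rotation of the basis gives the other equality.
Conversely, (ii) applied to X, J₁X, J₂X and J₃X yields enough relations to verify the identity at
every p in the span (`mul_commutator_eq`). -/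

noncomputable section

namespace Twistor

/-! ### Derivatives of maps into the total space of a vector bundle. -/

section TotalSpace

variable {B F N : Type*} {V : B → Type*}
  [NormedAddCommGroup F] [NormedSpace ℝ F]
  [TopologicalSpace (TotalSpace F V)] [∀ x, TopologicalSpace (V x)]
  {EB : Type*} [NormedAddCommGroup EB] [NormedSpace ℝ EB] {HB : Type*} [TopologicalSpace HB]
  {IB : ModelWithCorners ℝ EB HB}
  {EN : Type*} [NormedAddCommGroup EN] [NormedSpace ℝ EN] {HN : Type*} [TopologicalSpace HN]
  {IN : ModelWithCorners ℝ EN HN} [TopologicalSpace N] [ChartedSpace HN N]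
  [TopologicalSpace B] [ChartedSpace HB B] [FiberBundle F V]

/-- Near `f a` the chart of the total space is the base chart paired with the fibre coordinate of
the trivialization at `(f a).proj`, so the derivative can be taken componentwise. -/
theorem hasMFDerivAt_totalSpace {f : N → TotalSpace F V} {a : N}
    (hf : MDifferentiableAt IN (IB.prod 𝓘(ℝ, F)) f a) :
    HasMFDerivAt IN (IB.prod 𝓘(ℝ, F)) f a
      (ContinuousLinearMap.prod (M₂ := EB) (M₃ := F)
        (mfderiv IN IB (fun y => (f y).proj) a)
        (mfderiv IN 𝓘(ℝ, F) (fun y => (trivializationAt F V (f a).proj (f y)).2) a)) := by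
  obtain ⟨h1, h2⟩ := (mdifferentiableAt_totalSpace IB f).1 hf
  refine ⟨hf.continuousAt, ?_⟩
  have h := h1.hasMFDerivAt.2.prodMk h2.hasMFDerivAt.2
  have hmem : (fun y => (f y).proj) ⁻¹' (trivializationAt F V (f a).proj).baseSet ∈ 𝓝 a :=
    h1.continuousAt ((Trivialization.open_baseSet _).mem_nhds (mem_baseSet_trivializationAt F V _))
  have key : ∀ y, (f y).proj ∈ (trivializationAt F V (f a).proj).baseSet →
      extChartAt (IB.prod 𝓘(ℝ, F)) (f a) (f y) =
        (extChartAt IB (f a).proj (f y).proj, (trivializationAt F V (f a).proj (f y)).2) := by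
    intro y hy
    rw [FiberBundle.extChartAt]
    simp [Trivialization.coe_fst', hy]
  refine h.congr_of_eventuallyEq ?_ ?_
  · have hmem' := mem_nhdsWithin_of_mem_nhds (t := range IN)
      (extChartAt_preimage_mem_nhds (I := IN) hmem)
    filter_upwards [hmem'] with y hy
    exact key _ hy
  · simpa only [writtenInExtChartAt, Function.comp_apply, extChartAt_to_inv] using!
      key a (mem_of_mem_nhds hmem :)

theorem mfderiv_totalSpace_apply {f : N → TotalSpace F V} {a : N}
    (hf : MDifferentiableAt IN (IB.prod 𝓘(ℝ, F)) f a) (w : TangentSpace IN a) :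
    mfderiv IN (IB.prod 𝓘(ℝ, F)) f a w =
      ((mfderiv IN IB (fun y => (f y).proj) a w : EB),
        (mfderiv IN 𝓘(ℝ, F) (fun y => (trivializationAt F V (f a).proj (f y)).2) a w : F)) := by
  rw [(hasMFDerivAt_totalSpace hf).mfderiv]
  rfl

theorem mfderiv_proj_apply (p : TotalSpace F V) (w : EB × F) :
    mfderiv (IB.prod 𝓘(ℝ, F)) IB (fun q : TotalSpace F V => q.proj) p w = w.1 := by
  have h := mfderiv_totalSpace_apply (IB := IB) (mdifferentiableAt_id (x := p)) w
  rw [mfderiv_id] at h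
  exact (congrArg Prod.fst h).symm

theorem mfderiv_trivializationAt_snd_apply (p : TotalSpace F V) (w : EB × F) :
    mfderiv (IB.prod 𝓘(ℝ, F)) 𝓘(ℝ, F)
      (fun q : TotalSpace F V => (trivializationAt F V p.proj q).2) p w = w.2 := by
  have h := mfderiv_totalSpace_apply (IB := IB) (mdifferentiableAt_id (x := p)) w
  rw [mfderiv_id] at h
  exact (congrArg Prod.snd h).symm

theorem mdifferentiableAt_trivializationAt_snd (p : TotalSpace F V) :
    MDifferentiableAt (IB.prod 𝓘(ℝ, F)) 𝓘(ℝ, F)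
      (fun q : TotalSpace F V => (trivializationAt F V p.proj q).2) p :=
  ((mdifferentiableAt_totalSpace IB _).1 (mdifferentiableAt_id (x := p))).2

end TotalSpace

/-! ### Coordinates on TM, End(TM) and the frame bundle; Christoffel symbols. -/

section

variable {E : Type*} [NormedAddCommGroup E] [NormedSpace ℝ E]
  {M : Type*} [TopologicalSpace M] [ChartedSpace E M] [IsManifold 𝓘(ℝ, E) ∞ M]

variable (E M) in
/-- The preferred trivialization of `TM` at `x`. -/
abbrev triv (x : M) : Trivialization E (TotalSpace.proj : TangentBundle 𝓘(ℝ, E) M → M) :=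
  trivializationAt E (TangentSpace 𝓘(ℝ, E) : M → Type _) x

/-- Over its own base point the preferred trivialization is the identity, so no transition maps
appear in formulas evaluated at x. -/
theorem triv_continuousLinearMapAt_self (x : M) :
    (triv E M x).continuousLinearMapAt ℝ x = ContinuousLinearMap.id ℝ E := by
  rw [TangentBundle.continuousLinearMapAt_trivializationAt_eq_core (mem_chart_source E x)]
  ext v
  exact (tangentBundleCore 𝓘(ℝ, E) M).coordChange_self _ _ (mem_chart_source E x) v

theorem triv_symmL_self (x : M) :
    (triv E M x).symmL ℝ x = ContinuousLinearMap.id ℝ E := by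
  rw [TangentBundle.symmL_trivializationAt_eq_core (mem_chart_source E x)]
  ext v
  exact (tangentBundleCore 𝓘(ℝ, E) M).coordChange_self _ _ (mem_chart_source E x) v

/-- An endomorphism of `T_y M` in the trivialization at `x`. -/
def endCoord (x y : M) (B : EndFiber E M y) : E →L[ℝ] E :=
  (triv E M x).continuousLinearMapAt ℝ y ∘L B ∘L (triv E M x).symmL ℝ y

/-- A homomorphism `ℍⁿ → T_y M` in the trivialization at `x`. -/
def frameCoord {n : ℕ} (x y : M) (u : FrameFiber E M n y) : QuatSpace n →L[ℝ] E :=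
  (triv E M x).continuousLinearMapAt ℝ y ∘L u

theorem endBundle_trivializationAt_snd (x : M) (p : EndBundle E M) :
    (trivializationAt (E →L[ℝ] E) (EndFiber E M) x p).2 = endCoord x p.1 p.2 := rfl

theorem frameBundle_trivializationAt_snd {n : ℕ} (x : M) (p : FrameBundle E M n) :
    (trivializationAt (QuatSpace n →L[ℝ] E) (FrameFiber E M n) x p).2 = frameCoord x p.1 p.2 := by
  rw [hom_trivializationAt_apply]
  ext v
  simp [ContinuousLinearMap.inCoordinates, frameCoord]

theorem endCoord_self (x : M) (B : EndFiber E M x) : endCoord x x B = B := by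
  simp only [endCoord, triv_symmL_self, triv_continuousLinearMapAt_self]
  rfl

theorem frameCoord_self {n : ℕ} (x : M) (u : FrameFiber E M n x) : frameCoord x x u = u := by
  simp only [frameCoord, triv_continuousLinearMapAt_self]
  rfl

end

section

variable {E : Type*} [NormedAddCommGroup E] [NormedSpace ℝ E]
  {M : Type*} [TopologicalSpace M] [ChartedSpace E M] [IsManifold 𝓘(ℝ, E) ∞ M]

theorem triv_symmL_continuousLinearMapAt {x y : M} (hy : y ∈ (triv E M x).baseSet)
    (v : TangentSpace 𝓘(ℝ, E) y) :
    (triv E M x).symmL ℝ y ((triv E M x).continuousLinearMapAt ℝ y v) = v :=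
  (triv E M x).symmL_continuousLinearMapAt hy v

theorem endCoord_apply (x y : M) (B : EndFiber E M y) (v : E) :
    endCoord x y B v = (triv E M x).continuousLinearMapAt ℝ y (B ((triv E M x).symmL ℝ y v)) := rfl

theorem endCoord_comp {x y : M} (hy : y ∈ (triv E M x).baseSet) (A B : EndFiber E M y) :
    endCoord x y (A ∘L B) = endCoord x y A ∘L endCoord x y B := by
  ext v
  simp only [ContinuousLinearMap.comp_apply, endCoord_apply, triv_symmL_continuousLinearMapAt hy]

theorem endCoord_id {x y : M} (hy : y ∈ (triv E M x).baseSet) :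
    endCoord x y (ContinuousLinearMap.id ℝ (TangentSpace 𝓘(ℝ, E) y)) =
      ContinuousLinearMap.id ℝ E := by
  ext v
  simp only [endCoord_apply, ContinuousLinearMap.id_apply]
  exact (triv E M x).continuousLinearMapAt_symmL hy v

theorem endCoord_neg (x y : M) (A : EndFiber E M y) : endCoord x y (-A) = -endCoord x y A := by
  ext v
  simp only [endCoord_apply, neg_apply, map_neg]

theorem endCoord_smul (x y : M) (r : ℝ) (A : EndFiber E M y) :
    endCoord x y (r • A) = r • endCoord x y A := by
  ext v
  simp only [endCoord_apply, smul_apply, map_smul]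

theorem endCoord_add (x y : M) (A B : EndFiber E M y) :
    endCoord x y (A + B) = endCoord x y A + endCoord x y B := by
  ext v
  simp only [endCoord_apply, add_apply, map_add]

theorem inverse_frameCoord {n : ℕ} {x y : M} (hy : y ∈ (triv E M x).baseSet)
    (u : FrameFiber E M n y) :
    (frameCoord x y u).inverse = u.inverse ∘L (triv E M x).symmL ℝ y := by
  have h : frameCoord x y u = ((triv E M x).continuousLinearEquivAt ℝ y hy :
      TangentSpace 𝓘(ℝ, E) y →L[ℝ] E) ∘L u := by
    ext v
    exact congrArg (fun f : TangentSpace 𝓘(ℝ, E) y → E => f (u v))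
      ((triv E M x).coe_continuousLinearEquivAt_eq hy).symm
  rw [h]
  refine (ContinuousLinearMap.inverse_equiv_comp
    (e := (triv E M x).continuousLinearEquivAt ℝ y hy) (f := u)).trans ?_
  rw [(triv E M x).symm_continuousLinearEquivAt_eq' hy]

/-- Trivializing commutes with conjugation; hence in coordinates `jMap` is the map w ↦ w J⁰₃ w⁻¹
between fixed vector spaces. -/
theorem endCoord_conj {n : ℕ} {x y : M} (hy : y ∈ (triv E M x).baseSet)
    (u : FrameFiber E M n y) (B : QuatSpace n →L[ℝ] QuatSpace n) :
    endCoord x y (u ∘L B ∘L u.inverse) =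
      frameCoord x y u ∘L B ∘L (frameCoord x y u).inverse := by
  rw [inverse_frameCoord hy u]
  rfl

/-- A vector field in the trivialization at `x`. -/
def secCoord (x : M) (Y : ∀ y : M, TangentSpace 𝓘(ℝ, E) y) (y : M) : E :=
  (triv E M x ⟨y, Y y⟩).2

theorem secCoord_eq {x y : M} (hy : y ∈ (triv E M x).baseSet)
    (Y : ∀ y : M, TangentSpace 𝓘(ℝ, E) y) :
    secCoord x Y y = (triv E M x).continuousLinearMapAt ℝ y (Y y) :=
  ((triv E M x).continuousLinearMapAt_apply_of_mem ℝ hy (Y y)).symm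

theorem mdifferentiableAt_secCoord {x : M} {Y : ∀ y : M, TangentSpace 𝓘(ℝ, E) y} :
    MDifferentiableAt 𝓘(ℝ, E) 𝓘(ℝ, E).tangent
        (fun y => (⟨y, Y y⟩ : TangentBundle 𝓘(ℝ, E) M)) x ↔
      MDifferentiableAt 𝓘(ℝ, E) 𝓘(ℝ, E) (secCoord x Y) x :=
  mdifferentiableAt_section 𝓘(ℝ, E) Y

theorem secCoord_add_eventuallyEq (x : M) (Y Y' : ∀ y : M, TangentSpace 𝓘(ℝ, E) y) :
    secCoord x (Y + Y') =ᶠ[𝓝 x] secCoord x Y + secCoord x Y' := by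
  filter_upwards [(triv E M x).open_baseSet.mem_nhds (mem_baseSet_trivializationAt E _ x)]
    with y hy
  simp only [Pi.add_apply, secCoord_eq hy, map_add]

theorem secCoord_smul_eventuallyEq (x : M) (f : M → ℝ) (Y : ∀ y : M, TangentSpace 𝓘(ℝ, E) y) :
    secCoord x (f • Y) =ᶠ[𝓝 x] f • secCoord x Y := by
  filter_upwards [(triv E M x).open_baseSet.mem_nhds (mem_baseSet_trivializationAt E _ x)]
    with y hy
  simp only [Pi.smul_apply', secCoord_eq hy, map_smul]

theorem secCoord_self (x : M) (Y : ∀ y : M, TangentSpace 𝓘(ℝ, E) y) : secCoord x Y x = Y x := by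
  rw [secCoord_eq (mem_baseSet_trivializationAt E _ x), triv_continuousLinearMapAt_self]
  rfl

/-- The derivative at `x` of a vector field in the trivialization at `x`. -/
def secDeriv (x : M) (Y : ∀ y : M, TangentSpace 𝓘(ℝ, E) y) : EndFiber E M x :=
  mvfderiv 𝓘(ℝ, E) (secCoord x Y) x

theorem secDeriv_add {x : M} {Y Y' : ∀ y : M, TangentSpace 𝓘(ℝ, E) y}
    (h : MDifferentiableAt 𝓘(ℝ, E) 𝓘(ℝ, E) (secCoord x Y) x)
    (h' : MDifferentiableAt 𝓘(ℝ, E) 𝓘(ℝ, E) (secCoord x Y') x) :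
    secDeriv x (Y + Y') = secDeriv x Y + secDeriv x Y' := by
  rw [secDeriv, mvfderiv, (secCoord_add_eventuallyEq x Y Y').mfderiv_eq]
  exact mvfderiv_add h h'

theorem secDeriv_smul {x : M} {f : M → ℝ} {Y : ∀ y : M, TangentSpace 𝓘(ℝ, E) y}
    (hf : MDifferentiableAt 𝓘(ℝ, E) 𝓘(ℝ, ℝ) f x)
    (h : MDifferentiableAt 𝓘(ℝ, E) 𝓘(ℝ, E) (secCoord x Y) x) :
    secDeriv x (f • Y) = f x • secDeriv x Y + (mvfderiv 𝓘(ℝ, E) f x).smulRight (Y x) := by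
  rw [secDeriv, mvfderiv, (secCoord_smul_eventuallyEq x f Y).mfderiv_eq]
  refine (mvfderiv_smul hf h).trans ?_
  rw [secCoord_self]
  rfl

/-- The connection and the coordinate derivative obey the same Leibniz rule, so the terms in df
cancel in their difference. -/
theorem tensorialAt_sub_secDeriv (D : LinearConnection E M) (x : M) :
    TensorialAt 𝓘(ℝ, E) E (fun Y : ∀ y : M, TangentSpace 𝓘(ℝ, E) y => D Y x - secDeriv x Y) x where
  smul {f Y} hf hY := by
    change D (f • Y) x - secDeriv x (f • Y) = _
    rw [D.isCovariantDerivativeOnUniv.leibniz hY hf, secDeriv_smul hf (mdifferentiableAt_secCoord.1 hY)]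
    rw [smul_sub, add_sub_add_right_eq_sub]
  add {Y Y'} hY hY' := by
    change D (Y + Y') x - secDeriv x (Y + Y') = _
    rw [D.isCovariantDerivativeOnUniv.add hY hY',
      secDeriv_add (mdifferentiableAt_secCoord.1 hY) (mdifferentiableAt_secCoord.1 hY')]
    abel

variable [FiniteDimensional ℝ E]

/-- The Christoffel symbols of `D` at `x` in the trivialization at `x`:
`∇_X Y = dY(X) + Γ(X) Y`. -/
def christoffel (D : LinearConnection E M) (x : M) : E →L[ℝ] E →L[ℝ] E :=
  ContinuousLinearMap.flip (E := E) (F := E)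
    (TensorialAt.mkHom (A := EndFiber E M x) _ x (tensorialAt_sub_secDeriv D x))

theorem connection_apply (D : LinearConnection E M) {x : M} {Y : ∀ y : M, TangentSpace 𝓘(ℝ, E) y}
    (hY : MDifferentiableAt 𝓘(ℝ, E) 𝓘(ℝ, E).tangent
        (fun y => (⟨y, Y y⟩ : TangentBundle 𝓘(ℝ, E) M)) x) (X : E) :
    D Y x X = mvfderiv 𝓘(ℝ, E) (secCoord x Y) x X + christoffel D x X (Y x) := by
  have h := TensorialAt.mkHom_apply (tensorialAt_sub_secDeriv D x) hY
  have h' := congrArg (fun T : EndFiber E M x => T X) h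
  change christoffel D x X (Y x) = _ at h'
  rw [h']
  exact (add_sub_cancel (secDeriv x Y X) (D Y x X)).symm

omit [FiniteDimensional ℝ E] in
theorem exists_mdifferentiableAt_vectorField {x : M} (v : TangentSpace 𝓘(ℝ, E) x) :
    ∃ Y : ∀ y : M, TangentSpace 𝓘(ℝ, E) y,
      MDifferentiableAt 𝓘(ℝ, E) 𝓘(ℝ, E).tangent
        (fun y => (⟨y, Y y⟩ : TangentBundle 𝓘(ℝ, E) M)) x ∧ Y x = v :=
  ⟨FiberBundle.extend E v, FiberBundle.mdifferentiableAt_extend .., FiberBundle.extend_apply_self ..⟩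

theorem difference_eq_christoffel_sub (D D' : LinearConnection E M) (x : M) (v X : E) :
    D'.difference D x v X = christoffel D' x X v - christoffel D x X v := by
  obtain ⟨Y, hY, hYx⟩ := exists_mdifferentiableAt_vectorField (x := x) v
  have h := D'.isCovariantDerivativeOnUniv.difference_apply D.isCovariantDerivativeOnUniv
    (mem_univ x) hY
  have h' := congrArg (fun T : EndFiber E M x => T X) h
  rw [hYx] at h'
  refine h'.trans ?_
  change D' Y x X - D Y x X = _
  rw [connection_apply D' hY, connection_apply D hY, hYx]
  exact add_sub_add_left_eq_sub _ _ _

end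

/-! ### Horizontal lifts to the frame bundle. -/

section

variable {E : Type*} [NormedAddCommGroup E] [NormedSpace ℝ E]
  {M : Type*} [TopologicalSpace M] [ChartedSpace E M] [IsManifold 𝓘(ℝ, E) ∞ M]

theorem baseSet_mem_nhds (x : M) : (triv E M x).baseSet ∈ 𝓝 x :=
  (triv E M x).open_baseSet.mem_nhds (mem_baseSet_trivializationAt E _ x)

theorem mvfderiv_extChartAt_self (x : M) (X : TangentSpace 𝓘(ℝ, E) x) :
    mvfderiv 𝓘(ℝ, E) (extChartAt 𝓘(ℝ, E) x) x X = X := by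
  exact congrArg (fun T : E →L[ℝ] E => T X) (mfderiv_extChartAt_self (I := 𝓘(ℝ, E)) (x := x))

/-- Composition of a vector-valued function with a continuous linear map. -/
theorem mvfderiv_clm_comp {N : Type*} {EN : Type*} [NormedAddCommGroup EN] [NormedSpace ℝ EN]
    {HN : Type*} [TopologicalSpace HN] {IN : ModelWithCorners ℝ EN HN} [TopologicalSpace N]
    [ChartedSpace HN N]
    {F G : Type*} [NormedAddCommGroup F] [NormedSpace ℝ F] [NormedAddCommGroup G] [NormedSpace ℝ G]
    (L : F →L[ℝ] G) {f : N → F} {x : N} (hf : MDifferentiableAt IN 𝓘(ℝ, F) f x)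
    (X : TangentSpace IN x) :
    mvfderiv IN (fun y => L (f y)) x X = L (mvfderiv IN f x X) := by
  have h := (L.hasMFDerivAt (x := f x)).comp x hf.hasMFDerivAt
  exact congrArg (fun T => T X) h.mfderiv

section

variable {n : ℕ}

/-- The frame `u`, as a linear map into the model space. -/
def frameAt (u : FrameBundle E M n) : QuatSpace n →L[ℝ] E := u.2

theorem mdifferentiableAt_frameCoord {x : M} {s : ∀ y : M, FrameFiber E M n y} :
    MDifferentiableAt 𝓘(ℝ, E) (frameModel E n) (fun y => (⟨y, s y⟩ : FrameBundle E M n)) x ↔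
      MDifferentiableAt 𝓘(ℝ, E) 𝓘(ℝ, QuatSpace n →L[ℝ] E) (fun y => frameCoord x y (s y)) x := by
  rw [← funext fun y => frameBundle_trivializationAt_snd x (⟨y, s y⟩ : FrameBundle E M n)]
  exact mdifferentiableAt_section 𝓘(ℝ, E) s

theorem secCoord_frame_eventuallyEq (x : M) (s : ∀ y : M, FrameFiber E M n y) (e : QuatSpace n) :
    secCoord x (fun y => s y e) =ᶠ[𝓝 x] fun y => frameCoord x y (s y) e := by
  filter_upwards [baseSet_mem_nhds (E := E) x] with y hy
  rw [secCoord_eq hy]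
  rfl

theorem mdifferentiableAt_frame_apply {x : M} {s : ∀ y : M, FrameFiber E M n y}
    (hs : MDifferentiableAt 𝓘(ℝ, E) (frameModel E n)
      (fun y => (⟨y, s y⟩ : FrameBundle E M n)) x) (e : QuatSpace n) :
    MDifferentiableAt 𝓘(ℝ, E) 𝓘(ℝ, E).tangent
        (fun y => (⟨y, s y e⟩ : TangentBundle 𝓘(ℝ, E) M)) x := by
  refine mdifferentiableAt_secCoord.2 ?_
  refine MDifferentiableAt.congr_of_eventuallyEq ?_ (secCoord_frame_eventuallyEq x s e)
  exact (mdifferentiableAt_frameCoord.1 hs).clm_apply mdifferentiableAt_const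

theorem mvfderiv_secCoord_frame {x : M} {s : ∀ y : M, FrameFiber E M n y}
    (hs : MDifferentiableAt 𝓘(ℝ, E) (frameModel E n)
      (fun y => (⟨y, s y⟩ : FrameBundle E M n)) x) (e : QuatSpace n)
    (X : TangentSpace 𝓘(ℝ, E) x) :
    mvfderiv 𝓘(ℝ, E) (secCoord x (fun y => s y e)) x X =
      mvfderiv 𝓘(ℝ, E) (fun y => frameCoord x y (s y)) x X e := by
  rw [mvfderiv, (secCoord_frame_eventuallyEq x s e).mfderiv_eq]
  exact mvfderiv_clm_comp (ContinuousLinearMap.apply ℝ E e) (mdifferentiableAt_frameCoord.1 hs) X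

theorem mfderiv_frame_apply {x : M} {s : ∀ y : M, FrameFiber E M n y}
    (hs : MDifferentiableAt 𝓘(ℝ, E) (frameModel E n)
      (fun y => (⟨y, s y⟩ : FrameBundle E M n)) x) (X : TangentSpace 𝓘(ℝ, E) x) :
    mfderiv 𝓘(ℝ, E) (frameModel E n) (fun y => (⟨y, s y⟩ : FrameBundle E M n)) x X =
      ((X : E), mvfderiv 𝓘(ℝ, E) (fun y => frameCoord x y (s y)) x X) := by
  rw [mfderiv_totalSpace_apply hs]
  rw [← funext fun y => frameBundle_trivializationAt_snd x (⟨y, s y⟩ : FrameBundle E M n)]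
  refine Prod.ext ?_ rfl
  change mfderiv 𝓘(ℝ, E) 𝓘(ℝ, E) id x X = X
  rw [mfderiv_id]
  rfl

variable [FiniteDimensional ℝ E]

theorem connection_frame_apply (D : LinearConnection E M) {x : M}
    {s : ∀ y : M, FrameFiber E M n y}
    (hs : MDifferentiableAt 𝓘(ℝ, E) (frameModel E n)
      (fun y => (⟨y, s y⟩ : FrameBundle E M n)) x) (e : QuatSpace n)
    (X : TangentSpace 𝓘(ℝ, E) x) :
    D (fun y => s y e) x X =
      mvfderiv 𝓘(ℝ, E) (fun y => frameCoord x y (s y)) x X e + christoffel D x X (s x e) := by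
  exact (connection_apply D (mdifferentiableAt_frame_apply hs e) X).trans
    (congrArg (· + christoffel D x X (s x e)) (mvfderiv_secCoord_frame hs e X))

/-- The horizontal lift of `X` to the frame `u`, in the trivialization at `u.1`. -/
def horizontalLift (D : LinearConnection E M) (u : FrameBundle E M n) (X : E) :
    E × (QuatSpace n →L[ℝ] E) :=
  (X, -(christoffel D u.1 X ∘L frameAt u))

/-- Uniqueness of the lift: ∇_X s(e) = 0 for all e reads ds(X) + Γ(X)u = 0, which determines the
fibre component from X. -/
theorem eq_horizontalLift_of_mem (D : LinearConnection E M) {u : FrameBundle E M n}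
    {V : E × (QuatSpace n →L[ℝ] E)} (hV : V ∈ horizontalSpace D u) :
    V = horizontalLift D u V.1 := by
  obtain ⟨s, X, hs, hD, h⟩ := hV
  have hu : u = ⟨u.1, s u.1⟩ := congrArg TotalSpace.proj h
  have hV : V = mfderiv 𝓘(ℝ, E) (frameModel E n) (fun y => (⟨y, s y⟩ : FrameBundle E M n)) u.1 X :=
    congrArg (fun W : TangentBundle (frameModel E n) (FrameBundle E M n) =>
      (W.2 : E × (QuatSpace n →L[ℝ] E))) h
  rw [mfderiv_frame_apply hs X] at hV
  have hs2 : frameAt u = s u.1 := by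
    change u.2 = s u.1
    obtain ⟨x, v⟩ := u
    simpa using! hu
  subst hV
  refine Prod.ext rfl ?_
  ext e
  have := hD e
  rw [connection_frame_apply D hs e X] at this
  simp only [horizontalLift, hs2]
  exact eq_neg_of_add_eq_zero_left this

/-- A local frame through `u` which is parallel at the base point of `u`. -/
def parallelFrame (D : LinearConnection E M) (u : FrameBundle E M n) (y : M) :
    FrameFiber E M n y :=
  (triv E M u.1).symmL ℝ y ∘L (frameAt u -
    christoffel D u.1 (extChartAt 𝓘(ℝ, E) u.1 y - extChartAt 𝓘(ℝ, E) u.1 u.1) ∘L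
      frameAt u)

theorem frameCoord_parallelFrame (D : LinearConnection E M) (u : FrameBundle E M n) :
    (fun y => frameCoord u.1 y (parallelFrame D u y)) =ᶠ[𝓝 u.1] fun y =>
      frameAt u -
        christoffel D u.1 (extChartAt 𝓘(ℝ, E) u.1 y - extChartAt 𝓘(ℝ, E) u.1 u.1) ∘L
      frameAt u := by
  filter_upwards [baseSet_mem_nhds (E := E) u.1] with y hy
  ext e
  exact (triv E M u.1).continuousLinearMapAt_symmL hy _

theorem parallelFrame_self (D : LinearConnection E M) (u : FrameBundle E M n) :
    parallelFrame D u u.1 = u.2 := by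
  have h : frameCoord u.1 u.1 (parallelFrame D u u.1) = _ :=
    (frameCoord_parallelFrame D u).self_of_nhds
  rw [frameCoord_self] at h
  refine h.trans ?_
  simp only [sub_self, map_zero, ContinuousLinearMap.zero_comp, sub_zero]
  rfl

theorem hasMFDerivAt_parallelFrame (D : LinearConnection E M) (u : FrameBundle E M n) :
    MDifferentiableAt 𝓘(ℝ, E) 𝓘(ℝ, QuatSpace n →L[ℝ] E)
      (fun y => frameCoord u.1 y (parallelFrame D u y)) u.1 ∧
    ∀ X : TangentSpace 𝓘(ℝ, E) u.1,
      mvfderiv 𝓘(ℝ, E) (fun y => frameCoord u.1 y (parallelFrame D u y)) u.1 X =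
        -(christoffel D u.1 X ∘L frameAt u) := by
  let L : E →L[ℝ] (QuatSpace n →L[ℝ] E) :=
    (ContinuousLinearMap.precomp E (frameAt u)) ∘L christoffel D u.1
  have hφ : MDifferentiableAt 𝓘(ℝ, E) 𝓘(ℝ, E) (extChartAt 𝓘(ℝ, E) u.1) u.1 :=
    mdifferentiableAt_extChartAt (mem_chart_source E u.1)
  have hL : MDifferentiableAt 𝓘(ℝ, E) 𝓘(ℝ, QuatSpace n →L[ℝ] E)
      (fun y => L (extChartAt 𝓘(ℝ, E) u.1 y)) u.1 :=
    L.mdifferentiableAt.comp u.1 hφ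
  have heq : (fun y => frameCoord u.1 y (parallelFrame D u y)) =ᶠ[𝓝 u.1] fun y =>
      (frameAt u + L (extChartAt 𝓘(ℝ, E) u.1 u.1)) -
        L (extChartAt 𝓘(ℝ, E) u.1 y) := by
    filter_upwards [frameCoord_parallelFrame D u] with y hy
    rw [hy]
    ext e
    simp only [L, ContinuousLinearMap.comp_apply, map_sub, sub_apply, add_apply,
      ContinuousLinearMap.precomp_apply]
    abel
  refine ⟨(mdifferentiableAt_const.sub hL).congr_of_eventuallyEq heq, fun X => ?_⟩
  rw [mvfderiv, heq.mfderiv_eq]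
  refine (congrArg (fun T => T X) (mvfderiv_fun_sub mdifferentiableAt_const hL)).trans ?_
  simp only [sub_apply, mvfderiv_const, mvfderiv_clm_comp L hφ, mvfderiv_extChartAt_self]
  exact zero_sub _

/-- Existence of the lift: the frame that is u - Γ(φ(y) - φ(x))u in coordinates, φ being the chart,
is parallel to first order at x. -/
theorem horizontalLift_mem (D : LinearConnection E M) (u : FrameBundle E M n) (X : E) :
    horizontalLift D u X ∈ horizontalSpace D u := by
  obtain ⟨h1, h2⟩ := hasMFDerivAt_parallelFrame D u
  have hs := mdifferentiableAt_frameCoord.2 h1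
  refine ⟨parallelFrame D u, X, hs, fun e => ?_, ?_⟩
  · rw [connection_frame_apply D hs e X, h2 X, parallelFrame_self]
    exact neg_add_cancel _
  · have h3 := mfderiv_frame_apply hs X
    rw [h2 X] at h3
    have : (⟨u, horizontalLift D u X⟩ : TangentBundle (frameModel E n) (FrameBundle E M n)) =
      ⟨(⟨u.1, parallelFrame D u u.1⟩ : FrameBundle E M n), horizontalLift D u X⟩ := by
      rw [parallelFrame_self]
    exact this.trans (congrArg _ h3.symm)

theorem isStandardHorizontal_iff (D : LinearConnection E M) (ξ : QuatSpace n)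
    (u : FrameBundle E M n) (V : TangentSpace (frameModel E n) u) :
    IsStandardHorizontal D ξ u V ↔ V = horizontalLift D u (u.2 ξ) := by
  have h1 := mfderiv_proj_apply (IB := 𝓘(ℝ, E)) u V
  constructor
  · rintro ⟨hV, hξ⟩
    rw [eq_horizontalLift_of_mem D hV]
    exact congrArg _ (h1.symm.trans hξ)
  · rintro rfl
    exact ⟨horizontalLift_mem D u _, h1⟩

end

end

/-! ### The derivative of j(u) = u J⁰₃ u⁻¹. -/

section

variable {F G : Type*} [NormedAddCommGroup F] [NormedSpace ℝ F]
  [NormedAddCommGroup G] [NormedSpace ℝ G] [CompleteSpace F]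

theorem hasFDerivAt_conj (B : F →L[ℝ] F) {u : F →L[ℝ] G} (hu : u.IsInvertible) :
    DifferentiableAt ℝ (fun w : F →L[ℝ] G => w ∘L B ∘L w.inverse) u ∧
      ∀ v, fderiv ℝ (fun w : F →L[ℝ] G => w ∘L B ∘L w.inverse) u v =
        v ∘L B ∘L u.inverse - (u ∘L B ∘L u.inverse) ∘L v ∘L u.inverse := by
  have hinv : DifferentiableAt ℝ (fun w : F →L[ℝ] G => w.inverse) u := by
    obtain ⟨e, rfl⟩ := hu
    exact (contDiffAt_map_inverse (n := 1) e).differentiableAt one_ne_zero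
  have hd : DifferentiableAt ℝ (fun w : F →L[ℝ] G => w ∘L B ∘L w.inverse) u :=
    differentiableAt_id.clm_comp ((differentiableAt_const B).clm_comp hinv)
  refine ⟨hd, fun v => ?_⟩
  -- Differentiating (w B w⁻¹) w = w B and solving for the derivative of the first factor avoids a
  -- formula for the derivative of the inverse.
  have hev : (fun w : F →L[ℝ] G => (w ∘L B ∘L w.inverse) ∘L w) =ᶠ[𝓝 u] fun w => w ∘L B := by
    have hnhds : {w : F →L[ℝ] G | w.IsInvertible} ∈ 𝓝 u := by
      obtain ⟨e, rfl⟩ := hu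
      exact ContinuousLinearEquiv.nhds e
    filter_upwards [hnhds] with w hw
    ext x
    simp [ContinuousLinearMap.IsInvertible.inverse_apply_self hw]
  have h1 := hev.fderiv_eq (𝕜 := ℝ)
  have h2 := congrArg (fun T : (F →L[ℝ] G) →L[ℝ] (F →L[ℝ] G) => T v) h1
  rw [fderiv_clm_comp hd differentiableAt_fun_id,
    fderiv_clm_comp (differentiableAt_fun_id (𝕜 := ℝ) (E := F →L[ℝ] G))
      (differentiableAt_const B)] at h2
  simp only [fderiv_fun_id, fderiv_fun_const] at h2
  simp at h2
  ext x
  have h3 := congrArg (fun T : F →L[ℝ] G => T (u.inverse x)) h2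
  simp [hu.self_apply_inverse] at h3
  simp [← h3]

end

section

variable {E : Type*} [NormedAddCommGroup E] [NormedSpace ℝ E]
  {M : Type*} [TopologicalSpace M] [ChartedSpace E M] [IsManifold 𝓘(ℝ, E) ∞ M] {n : ℕ}

instance : CompleteSpace (QuatSpace n) := FiniteDimensional.complete ℝ _

theorem fundamentalVector_eq (A : QuatSpace n →L[ℝ] QuatSpace n) (u : FrameBundle E M n) :
    fundamentalVector A u = ((0 : E), frameAt u ∘L A) := by
  have hexp : HasDerivAt (fun t : ℝ => (NormedSpace.exp (t • A) : QuatSpace n →L[ℝ] QuatSpace n))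
      A 0 := by
    simpa using hasDerivAt_exp_smul_const (𝕂 := ℝ) A (0 : ℝ)
  have hc : HasDerivAt (fun t : ℝ => frameAt u ∘L
      (NormedSpace.exp (t • A) : QuatSpace n →L[ℝ] QuatSpace n)) (frameAt u ∘L A) 0 := by
    simpa using (hasDerivAt_const (0 : ℝ) (frameAt u)).clm_comp hexp
  let f : ℝ → FrameBundle E M n := fun t : ℝ =>
    ⟨u.1, u.2 ∘L (NormedSpace.exp (t • A) : QuatSpace n →L[ℝ] QuatSpace n)⟩
  have hsnd : (fun t => (trivializationAt (QuatSpace n →L[ℝ] E) (FrameFiber E M n) (f 0).proj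
      (f t)).2) = fun t : ℝ => frameAt u ∘L
      (NormedSpace.exp (t • A) : QuatSpace n →L[ℝ] QuatSpace n) := by
    funext t
    rw [frameBundle_trivializationAt_snd]
    exact frameCoord_self u.1 _
  have hf : MDifferentiableAt 𝓘(ℝ, ℝ) (frameModel E n) f 0 := by
    rw [mdifferentiableAt_totalSpace, hsnd]
    exact ⟨mdifferentiableAt_const, hc.differentiableAt.mdifferentiableAt⟩
  refine (mfderiv_totalSpace_apply hf (1 : ℝ)).trans (Prod.ext ?_ ?_)
  · change mfderiv 𝓘(ℝ, ℝ) 𝓘(ℝ, E) (fun _ : ℝ => u.1) 0 (1 : ℝ) = 0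
    rw [mfderiv_const]
    rfl
  · rw [hsnd]
    exact (congrArg (fun T : ℝ →L[ℝ] (QuatSpace n →L[ℝ] E) => T 1) mfderiv_eq_fderiv).trans
      hc.deriv

/-- The endomorphism `p`, as an endomorphism of the model space. -/
def endAt (p : EndBundle E M) : E →L[ℝ] E := p.2

omit [IsManifold 𝓘(ℝ, E) ∞ M] in
theorem endAt_jMap (u : FrameBundle E M n) :
    endAt (jMap n u) = frameAt u ∘L J0 n 2 ∘L (frameAt u).inverse := rfl

theorem mfderiv_jMap_apply {u : FrameBundle E M n} (hu : (frameAt u).IsInvertible)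
    (V : E × (QuatSpace n →L[ℝ] E)) :
    mfderiv (frameModel E n) (endModel E) (jMap n) u V =
      (V.1, V.2 ∘L J0 n 2 ∘L (frameAt u).inverse -
        endAt (jMap n u) ∘L V.2 ∘L (frameAt u).inverse) := by
  let c : FrameBundle E M n → (QuatSpace n →L[ℝ] E) :=
    fun q => (trivializationAt (QuatSpace n →L[ℝ] E) (FrameFiber E M n) u.1 q).2
  have hc : MDifferentiableAt (frameModel E n) 𝓘(ℝ, QuatSpace n →L[ℝ] E) c u :=
    mdifferentiableAt_trivializationAt_snd u
  have hcu : c u = frameAt u := by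
    simp only [c]
    rw [frameBundle_trivializationAt_snd]
    exact frameCoord_self u.1 _
  obtain ⟨hF, hF'⟩ := hasFDerivAt_conj (J0 n 2) hu
  have hproj : MDifferentiableAt (frameModel E n) 𝓘(ℝ, E)
      (fun q : FrameBundle E M n => q.proj) u := mdifferentiableAt_proj _
  have hsnd : (fun q => (trivializationAt (E →L[ℝ] E) (EndFiber E M) (jMap n u).proj
      (jMap n q)).2) =ᶠ[𝓝 u] fun q => c q ∘L J0 n 2 ∘L (c q).inverse := by
    filter_upwards [hproj.continuousAt (baseSet_mem_nhds (E := E) u.1)] with q hq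
    rw [endBundle_trivializationAt_snd]
    simp only [c]
    rw [frameBundle_trivializationAt_snd]
    exact endCoord_conj hq q.2 _
  rw [← hcu] at hF
  have hcomp := hF.hasFDerivAt.hasMFDerivAt.comp u hc.hasMFDerivAt
  have hj : MDifferentiableAt (frameModel E n) (endModel E) (jMap n) u := by
    rw [mdifferentiableAt_totalSpace]
    exact ⟨hproj, hcomp.mdifferentiableAt.congr_of_eventuallyEq hsnd⟩
  refine (mfderiv_totalSpace_apply hj V).trans (Prod.ext ?_ ?_)
  · exact mfderiv_proj_apply (IB := 𝓘(ℝ, E)) u V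
  · rw [hsnd.mfderiv_eq]
    change mfderiv (frameModel E n) 𝓘(ℝ, E →L[ℝ] E) _ u V = _
    refine (congrArg (fun T => T V) hcomp.mfderiv).trans ?_
    have h2 : mfderiv (frameModel E n) 𝓘(ℝ, QuatSpace n →L[ℝ] E) c u V = V.2 :=
      mfderiv_trivializationAt_snd_apply (IB := 𝓘(ℝ, E)) u V
    change fderiv ℝ _ (c u) (mfderiv (frameModel E n) 𝓘(ℝ, QuatSpace n →L[ℝ] E) c u V) = _
    rw [h2, hcu]
    exact hF' V.2

end

/-! ### Vertical parts and the coordinate formula for I₁. -/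

section

variable {E : Type*} [NormedAddCommGroup E] [NormedSpace ℝ E] [FiniteDimensional ℝ E]
  {M : Type*} [TopologicalSpace M] [ChartedSpace E M] [IsManifold 𝓘(ℝ, E) ∞ M] {n : ℕ}

/-- The commutator `[Γ(X), p]` with the Christoffel symbols. -/
def christoffelBracket (D : LinearConnection E M) (p : EndBundle E M) (X : E) : E →L[ℝ] E :=
  christoffel D p.1 X * endAt p - endAt p * christoffel D p.1 X

/-- The vertical part, with respect to `D`, of a vector tangent to `End(TM)` at `p`. -/
def vertPart (D : LinearConnection E M) (p : EndBundle E M) (W : E × (E →L[ℝ] E)) : E →L[ℝ] E :=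
  W.2 + christoffelBracket D p W.1

/-- The vector whose projection to `M` and vertical part are those of `W` multiplied by `p`. -/
def twist (D : LinearConnection E M) (p : EndBundle E M) (W : E × (E →L[ℝ] E)) :
    E × (E →L[ℝ] E) :=
  (endAt p W.1, endAt p * vertPart D p W - christoffelBracket D p (endAt p W.1))

/-- The horizontal lift of `X` to the frame `u`. -/
def horizontalVector (D : LinearConnection E M) (u : FrameBundle E M n) (X : E) :
    TangentSpace (frameModel E n) u :=
  horizontalLift D u X

theorem mfderiv_jMap_fundamentalVector_add (D : LinearConnection E M) {u : FrameBundle E M n}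
    (hu : (frameAt u).IsInvertible) (A : QuatSpace n →L[ℝ] QuatSpace n) (X : E) :
    mfderiv (frameModel E n) (endModel E) (jMap n) u (fundamentalVector A u +
        horizontalVector D u X) =
      (X, frameAt u ∘L (A * J0 n 2 - J0 n 2 * A) ∘L (frameAt u).inverse -
        christoffelBracket D (jMap n u) X) := by
  have h1 : (fundamentalVector A u + horizontalVector D u X) =
      ((X, frameAt u ∘L A - christoffel D u.1 X ∘L frameAt u) :
        E × (QuatSpace n →L[ℝ] E)) := by
    rw [fundamentalVector_eq]
    refine Prod.ext (zero_add X) ?_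
    exact (sub_eq_add_neg _ _).symm
  refine (congrArg (mfderiv (frameModel E n) (endModel E) (jMap n) u) h1).trans ?_
  rw [mfderiv_jMap_apply hu]
  refine Prod.ext rfl ?_
  change (frameAt u ∘L A - christoffel D u.1 X ∘L frameAt u) ∘L J0 n 2 ∘L (frameAt u).inverse -
    endAt (jMap n u) ∘L (frameAt u ∘L A - christoffel D u.1 X ∘L frameAt u) ∘L
      (frameAt u).inverse = _ - (christoffel D u.1 X ∘L endAt (jMap n u) -
        endAt (jMap n u) ∘L christoffel D u.1 X)
  rw [endAt_jMap]
  ext v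
  simp only [sub_apply, ContinuousLinearMap.comp_apply, ContinuousLinearMap.mul_def, map_sub,
    hu.inverse_apply_self, hu.self_apply_inverse]
  abel

/-- The image is determined by W alone, whatever u, A and ξ represent it. The computation behind it
is [J⁰₃A, J⁰₃] = J⁰₃[A, J⁰₃], carried to T_xM by u; it makes the choice in `I1` harmless. -/
theorem eq_twist_of_I1Graph {Q : AlmostQuaternionicStructure E M} {D : LinearConnection E M}
    {W W' : TangentBundle (endModel E) (EndBundle E M)} (h : I1Graph n Q D W W') :
    W' = ⟨W.1, twist D W.1 W.2⟩ := by
  obtain ⟨u, hu, A, hA, ξ, B, B', hB, hB', rfl, rfl⟩ := h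
  have hinv : (frameAt u).IsInvertible := hu.1
  rw [isStandardHorizontal_iff] at hB hB'
  subst hB hB'
  refine congrArg (TotalSpace.mk (jMap n u)) ?_
  have h1 := mfderiv_jMap_fundamentalVector_add D hinv A (frameAt u ξ)
  have h2 := mfderiv_jMap_fundamentalVector_add D hinv (J0 n 2 ∘L A) (frameAt u (J0 n 2 ξ))
  refine h2.trans (Eq.trans ?_ (congrArg (twist D (jMap n u)) h1).symm)
  have hz : endAt (jMap n u) (frameAt u ξ) = frameAt u (J0 n 2 ξ) := by
    rw [endAt_jMap]
    simp only [ContinuousLinearMap.comp_apply, hinv.inverse_apply_self]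
  refine Prod.ext hz.symm ?_
  simp only [twist, vertPart, sub_add_cancel, hz]
  congr 1
  rw [endAt_jMap]
  ext v
  simp only [sub_apply, ContinuousLinearMap.comp_apply, ContinuousLinearMap.mul_def, map_sub,
    hinv.inverse_apply_self]

/-- A vector tangent to End(TM) is known from its projection and its vertical part: ξ = u⁻¹X
realizes the first and A the second. -/
theorem I1Graph_twist {Q : AlmostQuaternionicStructure E M} (D : LinearConnection E M)
    {u : FrameBundle E M n} (hu : u ∈ quatFrames n Q) {A : QuatSpace n →L[ℝ] QuatSpace n}
    (hA : A ∈ m3 n) {W : E × (E →L[ℝ] E)}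
    (hW : vertPart D (jMap n u) W =
      frameAt u ∘L (A * J0 n 2 - J0 n 2 * A) ∘L (frameAt u).inverse) :
    I1Graph n Q D ⟨jMap n u, W⟩ ⟨jMap n u, twist D (jMap n u) W⟩ := by
  have hinv : (frameAt u).IsInvertible := hu.1
  obtain ⟨ξ, hξ⟩ : ∃ ξ, frameAt u ξ = W.1 := ⟨(frameAt u).inverse W.1, hinv.self_apply_inverse _⟩
  have key : I1Graph n Q D
      (tangentMap (frameModel E n) (endModel E) (jMap n) ⟨u, fundamentalVector A u +
        horizontalVector D u (frameAt u ξ)⟩)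
      (tangentMap (frameModel E n) (endModel E) (jMap n) ⟨u, fundamentalVector (J0 n 2 ∘L A) u +
        horizontalVector D u (frameAt u (J0 n 2 ξ))⟩) :=
    ⟨u, hu, A, hA, ξ, _, _, (isStandardHorizontal_iff D _ u _).2 rfl,
      (isStandardHorizontal_iff D _ u _).2 rfl, rfl, rfl⟩
  have h1 : tangentMap (frameModel E n) (endModel E) (jMap n) ⟨u, fundamentalVector A u +
        horizontalVector D u (frameAt u ξ)⟩ =
      (⟨jMap n u, W⟩ : TangentBundle (endModel E) (EndBundle E M)) := by
    refine congrArg (TotalSpace.mk (jMap n u)) ?_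
    refine (mfderiv_jMap_fundamentalVector_add D hinv A (frameAt u ξ)).trans ?_
    refine Prod.ext hξ ?_
    simp only [← hW, hξ, vertPart, add_sub_cancel_right]
  have h2 := eq_twist_of_I1Graph key
  rw [h1] at key h2
  rwa [h2] at key

theorem I1_eq_twist {Q : AlmostQuaternionicStructure E M} {D : LinearConnection E M}
    {W W' : TangentBundle (endModel E) (EndBundle E M)} (h : I1Graph n Q D W W') :
    I1 n Q D W = ⟨W.1, twist D W.1 W.2⟩ := by
  have hex : ∃ W', I1Graph n Q D W W' := ⟨W', h⟩
  rw [I1, dif_pos hex]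
  exact eq_twist_of_I1Graph hex.choose_spec

end

/-! ### Algebra of quaternion triples and quaternionic frames. -/

section QuaternionTriples

/-- Three elements of a ring which multiply like the imaginary unit quaternions. -/
structure IsQuatTriple {R : Type*} [Ring R] (J : Fin 3 → R) : Prop where
  sq : ∀ a, J a * J a = -1
  mul01 : J 0 * J 1 = J 2
  mul10 : J 1 * J 0 = -J 2

namespace IsQuatTriple

section Ring

variable {R : Type*} [Ring R] {J : Fin 3 → R} (h : IsQuatTriple J)
include h

theorem mul12 : J 1 * J 2 = J 0 := by
  rw [← neg_neg (J 2), ← h.mul10, mul_neg, ← mul_assoc, h.sq, neg_one_mul, neg_neg]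

theorem mul20 : J 2 * J 0 = J 1 := by
  rw [← neg_neg (J 2), ← h.mul10, neg_mul, mul_assoc, h.sq, mul_neg_one, neg_neg]

theorem mul21 : J 2 * J 1 = -J 0 := by
  rw [← h.mul01, mul_assoc, h.sq, mul_neg_one]

theorem mul02 : J 0 * J 2 = -J 1 := by
  rw [← h.mul01, ← mul_assoc, h.sq, neg_one_mul]

theorem rotate : IsQuatTriple (fun a => J (a + 1)) :=
  ⟨fun a => h.sq (a + 1), h.mul12, h.mul21⟩

end Ring

section Algebra

variable {R : Type*} [Ring R] [Algebra ℝ R] {J : Fin 3 → R} (h : IsQuatTriple J)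
include h

theorem sum_mul_sum (a b : Fin 3 → ℝ) :
    (∑ i, a i • J i) * (∑ i, b i • J i) = -(a 0 * b 0 + a 1 * b 1 + a 2 * b 2) • (1 : R) +
      ((a 1 * b 2 - a 2 * b 1) • J 0 + (a 2 * b 0 - a 0 * b 2) • J 1 +
        (a 0 * b 1 - a 1 * b 0) • J 2) := by
  simp only [Fin.sum_univ_three, add_mul, mul_add, smul_mul_assoc, mul_smul_comm,
    h.sq, h.mul01, h.mul10, h.mul12, h.mul20, h.mul21, h.mul02]
  module

theorem sum_sq (a : Fin 3 → ℝ) :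
    (∑ i, a i • J i) * (∑ i, a i • J i) = -(a 0 ^ 2 + a 1 ^ 2 + a 2 ^ 2) • (1 : R) := by
  rw [h.sum_mul_sum]
  module

theorem eq_zero_of_sum_eq_zero [Nontrivial R] {a : Fin 3 → ℝ} (ha : ∑ i, a i • J i = 0) :
    a 0 = 0 ∧ a 1 = 0 ∧ a 2 = 0 := by
  have h1 := h.sum_sq a
  rw [ha, mul_zero, eq_comm, smul_eq_zero_iff_left one_ne_zero, neg_eq_zero] at h1
  refine ⟨?_, ?_, ?_⟩ <;> nlinarith [sq_nonneg (a 0), sq_nonneg (a 1), sq_nonneg (a 2)]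

/-- Every element of the span which anticommutes with `J 2` is a commutator `A J₂ - J₂ A` with an
element `A` of the span which anticommutes with `J 2`. -/
theorem exists_commutator_eq {K : R} (hK : K ∈ Submodule.span ℝ (range J))
    (hK2 : K * J 2 = -(J 2 * K)) :
    ∃ A ∈ Submodule.span ℝ (range J), A * J 2 = -(J 2 * A) ∧ A * J 2 - J 2 * A = K := by
  -- The solution is A = ½ J₃K. Written as ¼[J₃, K] it is visibly in the span, since commutators
  -- have no scalar part; anticommutation identifies the two forms.
  have hA : (4⁻¹ : ℝ) • (J 2 * K - K * J 2) = (2⁻¹ : ℝ) • (J 2 * K) := by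
    rw [hK2]
    module
  have h1 : (2⁻¹ : ℝ) • (J 2 * K) * J 2 = (2⁻¹ : ℝ) • K := by
    rw [smul_mul_assoc, mul_assoc, hK2, mul_neg, ← mul_assoc, h.sq, neg_one_mul, neg_neg]
  have h2 : J 2 * (2⁻¹ : ℝ) • (J 2 * K) = -((2⁻¹ : ℝ) • K) := by
    rw [mul_smul_comm, ← mul_assoc, h.sq, neg_one_mul, smul_neg]
  refine ⟨(4⁻¹ : ℝ) • (J 2 * K - K * J 2), ?_, ?_, ?_⟩
  · obtain ⟨b, rfl⟩ := (Submodule.mem_span_range_iff_exists_fun ℝ).1 hK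
    have : (4⁻¹ : ℝ) • (J 2 * (∑ i, b i • J i) - (∑ i, b i • J i) * J 2) =
        (2⁻¹ * b 0) • J 1 - (2⁻¹ * b 1) • J 0 := by
      simp only [Fin.sum_univ_three, add_mul, mul_add, smul_mul_assoc, mul_smul_comm,
        h.sq, h.mul12, h.mul20, h.mul21, h.mul02]
      module
    rw [this]
    exact sub_mem (Submodule.smul_mem _ _ (Submodule.subset_span ⟨1, rfl⟩))
      (Submodule.smul_mem _ _ (Submodule.subset_span ⟨0, rfl⟩))
  · rw [hA, h1, h2, neg_neg]
  · rw [hA, h1, h2, sub_neg_eq_add]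
    module

end Algebra

end IsQuatTriple

theorem quatUnit_mul_self (a : Fin 3) : quatUnit a * quatUnit a = -1 := by
  fin_cases a <;> ext <;>
    simp only [Quaternion.re_mul, Quaternion.imI_mul, Quaternion.imJ_mul, Quaternion.imK_mul] <;>
    simp [quatUnit]

theorem quatUnit_zero_mul_one : quatUnit 0 * quatUnit 1 = quatUnit 2 := by
  ext <;>
    simp only [Quaternion.re_mul, Quaternion.imI_mul, Quaternion.imJ_mul, Quaternion.imK_mul] <;>
    simp [quatUnit]

theorem quatUnit_one_mul_zero : quatUnit 1 * quatUnit 0 = -quatUnit 2 := by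
  ext <;>
    simp only [Quaternion.re_mul, Quaternion.imI_mul, Quaternion.imJ_mul, Quaternion.imK_mul,
      Quaternion.re_neg, Quaternion.imI_neg, Quaternion.imJ_neg, Quaternion.imK_neg] <;>
    simp [quatUnit]

theorem star_quatUnit (a : Fin 3) : star (quatUnit a) = -quatUnit a := by
  fin_cases a <;> ext <;>
    simp only [Quaternion.re_star, Quaternion.imI_star, Quaternion.imJ_star, Quaternion.imK_star,
      Quaternion.re_neg, Quaternion.imI_neg, Quaternion.imJ_neg, Quaternion.imK_neg] <;>
    simp [quatUnit]

/-- Right multiplications compose in reverse order, and the sign in J⁰ₐ compensates: J⁰₁J⁰₂v = v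
j₂j₁ = -v j₃. -/
theorem isQuatTriple_J0 (n : ℕ) : IsQuatTriple (J0 n) where
  sq a := by
    ext v
    funext k
    change -(-(v k * quatUnit a) * quatUnit a) = -(v k)
    rw [neg_mul, mul_assoc, neg_neg, quatUnit_mul_self, mul_neg_one]
  mul01 := by
    ext v
    funext k
    change -(-(v k * quatUnit 1) * quatUnit 0) = -(v k * quatUnit 2)
    rw [neg_mul, mul_assoc, quatUnit_one_mul_zero, mul_neg, neg_neg]
  mul10 := by
    ext v
    funext k
    change -(-(v k * quatUnit 0) * quatUnit 1) = - -(v k * quatUnit 2)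
    rw [neg_mul, mul_assoc, quatUnit_zero_mul_one]

/-- Every quaternionic vector space of real dimension `4 n` is isomorphic to `ℍⁿ`. -/
theorem IsQuatTriple.exists_frame {E : Type*} [NormedAddCommGroup E] [NormedSpace ℝ E]
    [FiniteDimensional ℝ E] {n : ℕ} (hE : Module.finrank ℝ E = 4 * n) {J : Fin 3 → E →L[ℝ] E}
    (h : IsQuatTriple J) :
    ∃ u : QuatSpace n ≃L[ℝ] E, ∀ a v, u (J0 n a v) = J a (u v) := by
  let q : QuaternionAlgebra.Basis (E →L[ℝ] E) (-1 : ℝ) 0 (-1) :=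
    { i := J 0, j := J 1, k := J 2
      i_mul_i := by simp [h.sq]
      j_mul_j := by simp [h.sq]
      i_mul_j := h.mul01
      j_mul_i := by simp [h.mul10] }
  let φ : ℍ[ℝ] →ₐ[ℝ] (E →L[ℝ] E) := QuaternionAlgebra.lift q
  have hφ : ∀ a, φ (quatUnit a) = J a := by
    intro a
    change q.lift (quatUnit a) = J a
    fin_cases a <;> simp [QuaternionAlgebra.Basis.lift, quatUnit, q]
  -- The triple makes E a left vector space over the division ring ℍ; it therefore has a basis, of n
  -- elements by the dimension count.
  let _ : Module ℍ[ℝ] E := Module.compHom E (φ : ℍ[ℝ] →+* (E →L[ℝ] E))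
  have hsmul : ∀ (x : ℍ[ℝ]) (v : E), x • v = φ x v := fun _ _ => rfl
  have : IsScalarTower ℝ ℍ[ℝ] E := ⟨fun r x v => by simp [hsmul]⟩
  have : Module.Finite ℍ[ℝ] E := Module.Finite.of_restrictScalars_finite ℝ ℍ[ℝ] E
  have hrank : Module.finrank ℍ[ℝ] E = n := by
    have := Module.finrank_mul_finrank ℝ ℍ[ℝ] E
    rw [hE, Quaternion.finrank_eq_four] at this
    omega
  let b := Module.finBasisOfFinrankEq ℍ[ℝ] E hrank
  -- Conjugation reverses products and negates jₐ, so it turns v ↦ -v jₐ into left multiplication by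
  -- jₐ.
  let c : QuatSpace n ≃ₗ[ℝ] (Fin n → ℍ[ℝ]) :=
    { toFun := fun v k => star (v k)
      invFun := fun v k => star (v k)
      map_add' := fun v w => funext fun k => star_add (v k) (w k)
      map_smul' := fun r v => funext fun k => Quaternion.star_smul r (v k)
      left_inv := fun v => funext fun k => star_star (v k)
      right_inv := fun v => funext fun k => star_star (v k) }
  let u : QuatSpace n ≃ₗ[ℝ] E := c.trans (b.equivFun.symm.restrictScalars ℝ)
  refine ⟨u.toContinuousLinearEquiv, fun a v => ?_⟩
  have hc : c (J0 n a v) = quatUnit a • c v := by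
    funext k
    change star (-(v k * quatUnit a)) = quatUnit a * star (v k)
    rw [star_neg, star_mul, star_quatUnit, neg_mul, neg_neg]
  change b.equivFun.symm (c (J0 n a v)) = J a (b.equivFun.symm (c v))
  rw [hc, map_smul, hsmul, hφ]

end QuaternionTriples

/-! ### The trace form and curves in the span of a moving triple. -/

section Trace

variable {E : Type*} [NormedAddCommGroup E] [NormedSpace ℝ E] [FiniteDimensional ℝ E]

variable (E) in
/-- The trace of an endomorphism, as a continuous linear form. -/
def traceL : (E →L[ℝ] E) →L[ℝ] ℝ :=
  LinearMap.toContinuousLinearMap (LinearMap.trace ℝ E ∘ₗ ContinuousLinearMap.coeLM ℝ)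

theorem traceL_mul_comm (A B : E →L[ℝ] E) : traceL E (A * B) = traceL E (B * A) :=
  LinearMap.trace_mul_comm ℝ (A : E →ₗ[ℝ] E) (B : E →ₗ[ℝ] E)

theorem traceL_one : traceL E 1 = Module.finrank ℝ E :=
  LinearMap.trace_one ℝ E

namespace IsQuatTriple

variable {J : Fin 3 → E →L[ℝ] E} (h : IsQuatTriple J)
include h

/-- J₃ equals both J₁J₂ and -J₂J₁, whose traces are opposite. -/
theorem traceL_two : traceL E (J 2) = 0 := by
  have h1 := traceL_mul_comm (J 0) (J 1)
  rw [h.mul01, h.mul10, map_neg] at h1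
  linarith

theorem traceL_eq_zero (a : Fin 3) : traceL E (J a) = 0 := by
  fin_cases a
  · exact h.rotate.traceL_two
  · exact h.rotate.rotate.traceL_two
  · exact h.traceL_two

theorem traceL_mul_sum (i : Fin 3) (a : Fin 3 → ℝ) :
    traceL E (J i * ∑ j, a j • J j) = -(Module.finrank ℝ E * a i) := by
  fin_cases i <;>
  simp [Fin.sum_univ_three, mul_add, h.sq, h.mul01, h.mul10, h.mul12, h.mul20, h.mul21, h.mul02,
    h.traceL_eq_zero, traceL_one, mul_comm]

end IsQuatTriple

/-- A differentiable curve in the span of a moving quaternion triple has differentiable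
coefficients. -/
theorem exists_deriv_eq_of_mem_span [Nontrivial E] {g : ℝ → E →L[ℝ] E}
    {h : Fin 3 → ℝ → E →L[ℝ] E} (hg : DifferentiableAt ℝ g 0)
    (hh : ∀ i, DifferentiableAt ℝ (h i) 0) (hq : ∀ᶠ t in 𝓝 (0 : ℝ), IsQuatTriple (fun i => h i t))
    (hmem : ∀ᶠ t in 𝓝 (0 : ℝ), g t ∈ Submodule.span ℝ (range fun i => h i t)) :
    ∃ a b : Fin 3 → ℝ, g 0 = ∑ i, a i • h i 0 ∧
      deriv g 0 = ∑ i, b i • h i 0 + ∑ i, a i • deriv (h i) 0 := by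
  -- Since tr(JᵢJⱼ) = -dim E · δᵢⱼ, the trace recovers the coefficients by a formula differentiable
  -- in t.
  let a : Fin 3 → ℝ → ℝ := fun i t => -(Module.finrank ℝ E : ℝ)⁻¹ * traceL E (h i t * g t)
  have ha : ∀ i, DifferentiableAt ℝ (a i) 0 := fun i =>
    ((traceL E).differentiableAt.comp 0 ((hh i).mul hg)).const_mul _
  have hN : (Module.finrank ℝ E : ℝ) ≠ 0 := by
    exact_mod_cast (Module.finrank_pos (R := ℝ) (M := E)).ne'
  have hev : g =ᶠ[𝓝 0] fun t => ∑ i, a i t • h i t := by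
    filter_upwards [hq, hmem] with t hqt hmt
    obtain ⟨b, hb⟩ := (Submodule.mem_span_range_iff_exists_fun ℝ).1 hmt
    have hab : ∀ i, a i t = b i := by
      intro i
      simp only [a]
      rw [← hb, hqt.traceL_mul_sum i b]
      field_simp
    simp only [hab, hb]
  refine ⟨fun i => a i 0, fun i => deriv (a i) 0, hev.self_of_nhds, ?_⟩
  rw [hev.deriv_eq, deriv_fun_sum (A := fun i t => a i t • h i t) fun i _ => (ha i).smul (hh i),
    ← Finset.sum_add_distrib]
  refine Finset.sum_congr rfl fun i _ => ?_
  rw [deriv_fun_smul (ha i) (hh i), add_comm]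

end Trace

/-! ### Admissible bases in a trivialization. -/

section

variable {E : Type*} [NormedAddCommGroup E] [NormedSpace ℝ E]
  {M : Type*} [TopologicalSpace M] [ChartedSpace E M] [IsManifold 𝓘(ℝ, E) ∞ M] {n : ℕ}

theorem mvfderiv_clm_apply {N : Type*} {EN : Type*} [NormedAddCommGroup EN] [NormedSpace ℝ EN]
    {HN : Type*} [TopologicalSpace HN] {IN : ModelWithCorners ℝ EN HN} [TopologicalSpace N]
    [ChartedSpace HN N]
    {F G : Type*} [NormedAddCommGroup F] [NormedSpace ℝ F] [NormedAddCommGroup G] [NormedSpace ℝ G]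
    {f : N → F →L[ℝ] G} {g : N → F} {x : N} (hf : MDifferentiableAt IN 𝓘(ℝ, F →L[ℝ] G) f x)
    (hg : MDifferentiableAt IN 𝓘(ℝ, F) g x) (X : TangentSpace IN x) :
    mvfderiv IN (fun y => f y (g y)) x X = f x (mvfderiv IN g x X) + mvfderiv IN f x X (g x) := by
  let g' : EN →L[ℝ] F := mvfderiv IN g x
  let f' : EN →L[ℝ] F →L[ℝ] G := mvfderiv IN f x
  have h : HasMFDerivAt IN 𝓘(ℝ, G) (fun y => f y (g y)) x (f x ∘L g' + f'.flip (g x)) := by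
    refine ⟨hf.continuousAt.clm_apply hg.continuousAt, ?_⟩
    have := HasFDerivWithinAt.clm_apply hf.hasMFDerivAt.2 hg.hasMFDerivAt.2
    simpa using! this
  exact congrArg (fun T : EN →L[ℝ] G => T X) h.mfderiv

variable {Q : ∀ x : M, Submodule ℝ (EndFiber E M x)} {U : Set M}
  {J : Fin 3 → ∀ x : M, EndFiber E M x}

/-- The endomorphism `J a x`, as an endomorphism of the model space. -/
def tripleAt (J : Fin 3 → ∀ x : M, EndFiber E M x) (x : M) (a : Fin 3) : E →L[ℝ] E := J a x

theorem IsAdmissibleBasis.isQuatTriple (h : IsAdmissibleBasis Q U J) {x : M} (hx : x ∈ U) :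
    IsQuatTriple (tripleAt J x) :=
  ⟨fun a => h.sq x hx a, h.mul x hx, h.mul_rev x hx⟩

/-- The subspace `Q x`, as a subspace of the endomorphisms of the model space. -/
def fiberAt (Q : ∀ x : M, Submodule ℝ (EndFiber E M x)) (x : M) : Submodule ℝ (E →L[ℝ] E) := Q x

theorem IsAdmissibleBasis.fiberAt_eq (h : IsAdmissibleBasis Q U J) {x : M} (hx : x ∈ U) :
    fiberAt Q x = Submodule.span ℝ (range (tripleAt J x)) :=
  h.span x hx

theorem IsAdmissibleBasis.isQuatTriple_endCoord (h : IsAdmissibleBasis Q U J) {x y : M}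
    (hy : y ∈ (triv E M x).baseSet) (hyU : y ∈ U) :
    IsQuatTriple (fun a => endCoord x y (J a y)) where
  sq a := by
    refine (endCoord_comp hy _ _).symm.trans ?_
    rw [h.sq y hyU, endCoord_neg, endCoord_id hy]
    rfl
  mul01 := (endCoord_comp hy _ _).symm.trans (by rw [h.mul y hyU])
  mul10 := (endCoord_comp hy _ _).symm.trans (by rw [h.mul_rev y hyU, endCoord_neg])

theorem IsAdmissibleBasis.endCoord_mem_span (h : IsAdmissibleBasis Q U J) {x y : M}
    (hyU : y ∈ U) {B : EndFiber E M y} (hB : B ∈ Q y) :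
    endCoord x y B ∈ Submodule.span ℝ (range fun a => endCoord x y (J a y)) := by
  rw [h.span y hyU, Submodule.mem_span_range_iff_exists_fun] at hB
  obtain ⟨c, rfl⟩ := hB
  rw [Submodule.mem_span_range_iff_exists_fun]
  exact ⟨c, by simp only [Fin.sum_univ_three, endCoord_add, endCoord_smul]⟩

theorem IsAdmissibleBasis.mdifferentiableAt_endCoord (h : IsAdmissibleBasis Q U J) {x : M}
    (hx : x ∈ U) (a : Fin 3) :
    MDifferentiableAt 𝓘(ℝ, E) 𝓘(ℝ, E →L[ℝ] E) (fun y => endCoord x y (J a y)) x :=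
  (mdifferentiableAt_section 𝓘(ℝ, E) (J a)).1
    (((h.smooth a).contMDiffAt (h.isOpen.mem_nhds hx)).mdifferentiableAt (by simp))

variable [FiniteDimensional ℝ E]

/-- A frame intertwining J⁰ₐ with Jₐ carries sp(1) onto Q_x, so it belongs to Q(M), and j sends it
to J₃. -/
theorem IsAdmissibleBasis.exists_quatFrame {Q : AlmostQuaternionicStructure E M}
    (hE : Module.finrank ℝ E = 4 * n) (h : IsAdmissibleBasis Q.fiber U J) {x : M} (hx : x ∈ U) :
    (⟨x, J 2 x⟩ : EndBundle E M) ∈ twistorSpace n Q := by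
  obtain ⟨u, hu⟩ := (h.isQuatTriple hx).exists_frame hE
  have hconj : ∀ a, (u : QuatSpace n →L[ℝ] E) ∘L J0 n a ∘L
      (u : QuatSpace n →L[ℝ] E).inverse = tripleAt J x a := by
    intro a
    ext v
    rw [ContinuousLinearMap.inverse_equiv]
    simp [hu]
  refine ⟨⟨x, (u : QuatSpace n →L[ℝ] E)⟩, ⟨⟨u, rfl⟩, ?_⟩, ?_⟩
  · let L : (QuatSpace n →L[ℝ] QuatSpace n) →ₗ[ℝ] (E →L[ℝ] E) :=
      { toFun := fun B => (u : QuatSpace n →L[ℝ] E) ∘L B ∘L (u : QuatSpace n →L[ℝ] E).inverse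
        map_add' := fun B B' => by
          ext v
          simp
        map_smul' := fun r B => by
          ext v
          simp }
    have hL : L ∘ J0 n = tripleAt J x := funext hconj
    have hmap : (sp1 n).map L = Submodule.span ℝ (range (tripleAt J x)) := by
      rw [sp1, Submodule.map_span, ← range_comp, hL]
    rw [h.span x hx]
    exact congrArg (fun S : Submodule ℝ (E →L[ℝ] E) => (S : Set (E →L[ℝ] E))) hmap.symm
  · exact congrArg (TotalSpace.mk x) (hconj 2)

end

/-! ### Quaternionic connections and the tangent vectors of the twistor space. -/

section

variable {E : Type*} [NormedAddCommGroup E] [NormedSpace ℝ E] [FiniteDimensional ℝ E]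
  {M : Type*} [TopologicalSpace M] [ChartedSpace E M] [IsManifold 𝓘(ℝ, E) ∞ M] {n : ℕ}
  {Q : AlmostQuaternionicStructure E M} {U : Set M} {J : Fin 3 → ∀ x : M, EndFiber E M x}

/-- The induced connection on End(TM) is ∇_X B = dB(X) + [Γ(X), B]; the derivatives of Y cancel. -/
theorem connection_endomorphism_apply (D : LinearConnection E M) {x : M}
    {B : ∀ y : M, EndFiber E M y}
    (hB : MDifferentiableAt 𝓘(ℝ, E) 𝓘(ℝ, E →L[ℝ] E) (fun y => endCoord x y (B y)) x)
    {Y : ∀ y : M, TangentSpace 𝓘(ℝ, E) y}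
    (hY : MDifferentiableAt 𝓘(ℝ, E) 𝓘(ℝ, E).tangent
      (fun y => (⟨y, Y y⟩ : TangentBundle 𝓘(ℝ, E) M)) x) (X : TangentSpace 𝓘(ℝ, E) x) :
    D (fun y => B y (Y y)) x X - B x (D Y x X) =
      (mvfderiv 𝓘(ℝ, E) (fun y => endCoord x y (B y)) x X +
        christoffelBracket D (⟨x, B x⟩ : EndBundle E M) X) (Y x) := by
  have hYc := mdifferentiableAt_secCoord.1 hY
  have hev : secCoord x (fun y => B y (Y y)) =ᶠ[𝓝 x]
      fun y => endCoord x y (B y) (secCoord x Y y) := by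
    filter_upwards [baseSet_mem_nhds (E := E) x] with y hy
    rw [secCoord_eq hy, secCoord_eq hy, endCoord_apply, triv_symmL_continuousLinearMapAt hy]
  have hBY : MDifferentiableAt 𝓘(ℝ, E) 𝓘(ℝ, E).tangent
      (fun y => (⟨y, B y (Y y)⟩ : TangentBundle 𝓘(ℝ, E) M)) x :=
    mdifferentiableAt_secCoord.2 ((hB.clm_apply hYc).congr_of_eventuallyEq hev)
  have h1 := connection_apply D hBY X
  have h2 := connection_apply D hY X
  let z : E →L[ℝ] E := B x
  let v : E := Y x
  let w : E := mvfderiv 𝓘(ℝ, E) (secCoord x Y) x X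
  let dB : E →L[ℝ] E := mvfderiv 𝓘(ℝ, E) (fun y => endCoord x y (B y)) x X
  let G : E →L[ℝ] E := christoffel D x X
  have h3 : mvfderiv 𝓘(ℝ, E) (secCoord x (fun y => B y (Y y))) x X = z w + dB v := by
    rw [mvfderiv, hev.mfderiv_eq]
    refine (mvfderiv_clm_apply hB hYc X).trans ?_
    rw [endCoord_self, secCoord_self]
  have h4 : B x (D Y x X) = z w + z (G v) := (congrArg z h2).trans (map_add z _ _)
  refine (congrArg₂ (fun v w : E => v - w) (h1.trans (congrArg (· + _) h3)) h4).trans ?_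
  change z w + dB v + G (z v) - (z w + z (G v)) = dB v + (G (z v) - z (G v))
  abel

theorem IsQuaternionic.exists_oneForms {D : LinearConnection E M} (hD : IsQuaternionic Q D)
    (h : IsAdmissibleBasis Q.fiber U J) :
    ∃ θ : Fin 3 → ∀ x : M, TangentSpace 𝓘(ℝ, E) x →L[ℝ] ℝ, ∀ x ∈ U,
      ∀ (X : TangentSpace 𝓘(ℝ, E) x) (a : Fin 3),
        mvfderiv 𝓘(ℝ, E) (fun y => endCoord x y (J a y)) x X +
          christoffelBracket D (⟨x, J a x⟩ : EndBundle E M) X =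
        -(θ (a + 1) x X • tripleAt J x (a + 2)) + θ (a + 2) x X • tripleAt J x (a + 1) := by
  obtain ⟨θ, hθ⟩ := hD.parallel U J h
  refine ⟨θ, fun x hx X a => ?_⟩
  ext v
  obtain ⟨Y, hY, hYx⟩ := exists_mdifferentiableAt_vectorField (x := x) v
  have h1 := connection_endomorphism_apply D (h.mdifferentiableAt_endCoord hx a) hY X
  have h2 := h1.symm.trans (hθ x hx Y hY X a)
  rw [hYx] at h2
  exact h2

omit [FiniteDimensional ℝ E] in
theorem mem_fiberAt_of_mem_twistorSpace {p : EndBundle E M} (hp : p ∈ twistorSpace n Q) :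
    endAt p ∈ fiberAt Q.fiber p.1 := by
  obtain ⟨u, hu, rfl⟩ := hp
  have : u.2 ∘L J0 n 2 ∘L u.2.inverse ∈ (Q.fiber u.1 : Set (EndFiber E M u.1)) := by
    rw [hu.2]
    exact ⟨J0 n 2, Submodule.subset_span ⟨2, rfl⟩, rfl⟩
  exact this

omit [FiniteDimensional ℝ E] in
theorem endAt_mul_self_of_mem_twistorSpace {p : EndBundle E M} (hp : p ∈ twistorSpace n Q) :
    endAt p * endAt p = -1 := by
  obtain ⟨u, hu, rfl⟩ := hp
  have hinv : (frameAt u).IsInvertible := hu.1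
  have hJ : ∀ v, J0 n 2 (J0 n 2 v) = -v := fun v =>
    congrArg (fun T : QuatSpace n →L[ℝ] QuatSpace n => T v) ((isQuatTriple_J0 n).sq 2)
  rw [endAt_jMap]
  ext v
  simp only [ContinuousLinearMap.mul_def, ContinuousLinearMap.comp_apply, hinv.inverse_apply_self,
    hJ, map_neg, hinv.self_apply_inverse]
  rfl

omit [FiniteDimensional ℝ E] in
theorem comp_self_of_mem_twistorSpace {p : EndBundle E M} (hp : p ∈ twistorSpace n Q) :
    p.2 ∘L p.2 = (-ContinuousLinearMap.id ℝ (TangentSpace 𝓘(ℝ, E) p.1) : EndFiber E M p.1) := by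
  have h := endAt_mul_self_of_mem_twistorSpace hp
  exact h

/-- Along a curve g = Σ aᵢJᵢ in Z, the vertical part of the velocity is its covariant derivative Σ
aᵢ'Jᵢ + Σ aᵢ∇_X Jᵢ, which lies in Q because ∇ is quaternionic. Anticommutation comes from
differentiating g² = -1. -/
theorem vertPart_mem_and_anticomm [Nontrivial E] {D : LinearConnection E M}
    (hD : IsQuaternionic Q D)
    {W : TangentBundle (endModel E) (EndBundle E M)} (hW : W ∈ tangentTwistorSpace n Q) :
    W.1 ∈ twistorSpace n Q ∧
      vertPart D W.1 W.2 ∈ fiberAt Q.fiber W.1.1 ∧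
      vertPart D W.1 W.2 * endAt W.1 = -(endAt W.1 * vertPart D W.1 W.2) := by
  obtain ⟨γ, ε, hε, hγ, hZ, rfl⟩ := hW
  have h0 : Ioo (-ε) ε ∈ 𝓝 (0 : ℝ) := Ioo_mem_nhds (by linarith) hε
  have hmem0 : (0 : ℝ) ∈ Ioo (-ε) ε := mem_of_mem_nhds h0
  have hd : MDifferentiableAt 𝓘(ℝ, ℝ) (endModel E) γ 0 :=
    (hγ.contMDiffAt h0).mdifferentiableAt (by simp)
  obtain ⟨hc, hg⟩ := (mdifferentiableAt_totalSpace 𝓘(ℝ, E) γ).1 hd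
  have hdc := mfderiv_totalSpace_apply hd (1 : ℝ)
  let x : M := (γ 0).1
  let g : ℝ → E →L[ℝ] E := fun t => endCoord x (γ t).1 (γ t).2
  let X : E := mfderiv 𝓘(ℝ, ℝ) 𝓘(ℝ, E) (fun t => (γ t).proj) 0 (1 : ℝ)
  have hgd : DifferentiableAt ℝ g 0 := mdifferentiableAt_iff_differentiableAt.1 hg
  have hW : (tangentMap 𝓘(ℝ, ℝ) (endModel E) γ ⟨0, (1 : ℝ)⟩).2 = ((X, deriv g 0) : E × (E →L[ℝ] E)) := by
    refine hdc.trans (Prod.ext rfl ?_)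
    exact congrArg (fun T : ℝ →L[ℝ] (E →L[ℝ] E) => T 1) (mfderiv_eq_fderiv (f := g))
  have hg0 : g 0 = endAt (γ 0) := endCoord_self _ _
  obtain ⟨U, J, hxU, h⟩ := Q.exists_basis x
  have hcont : Filter.Tendsto (fun t => (γ t).proj) (𝓝 0) (𝓝 x) := hc.continuousAt
  have hbase : ∀ᶠ t in 𝓝 (0 : ℝ), (γ t).proj ∈ (triv E M x).baseSet :=
    hcont (baseSet_mem_nhds (E := E) x)
  have hU : ∀ᶠ t in 𝓝 (0 : ℝ), (γ t).proj ∈ U := hcont (h.isOpen.mem_nhds hxU)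
  change γ 0 ∈ _ ∧ vertPart D (γ 0) _ ∈ fiberAt Q.fiber x ∧
    vertPart D (γ 0) _ * endAt (γ 0) = -(endAt (γ 0) * vertPart D (γ 0) _)
  rw [hW]
  refine ⟨hZ 0 hmem0, ?_, ?_⟩
  · let h' : Fin 3 → ℝ → E →L[ℝ] E := fun i t => endCoord x (γ t).1 (J i (γ t).1)
    have hJ := h.mdifferentiableAt_endCoord hxU
    have hh : ∀ i, HasDerivAt (h' i)
        (mvfderiv 𝓘(ℝ, E) (fun y => endCoord x y (J i y)) x X) 0 := by
      intro i
      have h1 := (hJ i).hasMFDerivAt.comp (0 : ℝ) hc.hasMFDerivAt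
      have h2 : HasFDerivAt (h' i) (_ : ℝ →L[ℝ] (E →L[ℝ] E)) 0 :=
        hasMFDerivAt_iff_hasFDerivAt.1 h1
      exact h2.hasDerivAt
    have hq : ∀ᶠ t in 𝓝 (0 : ℝ), IsQuatTriple (fun i => h' i t) := by
      filter_upwards [hbase, hU] with t ht htU
      exact h.isQuatTriple_endCoord ht htU
    have hmem : ∀ᶠ t in 𝓝 (0 : ℝ), g t ∈ Submodule.span ℝ (range fun i => h' i t) := by
      filter_upwards [hU, h0] with t htU ht
      exact h.endCoord_mem_span htU (mem_fiberAt_of_mem_twistorSpace (hZ t ht))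
    obtain ⟨a, b, ha, hb⟩ := exists_deriv_eq_of_mem_span hgd (fun i => (hh i).differentiableAt)
      hq hmem
    have hh0 : ∀ i, h' i 0 = tripleAt J x i := fun i => endCoord_self _ _
    simp only [hh0, (hh _).deriv] at ha hb
    obtain ⟨θ, hθ⟩ := hD.exists_oneForms h
    have hmemJ : ∀ i, tripleAt J x i ∈ Submodule.span ℝ (range (tripleAt J x)) :=
      fun i => Submodule.subset_span ⟨i, rfl⟩
    have key : vertPart D (γ 0) (X, deriv g 0) = ∑ i, b i • tripleAt J x i +
        ∑ i, a i • (mvfderiv 𝓘(ℝ, E) (fun y => endCoord x y (J i y)) x X +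
          christoffelBracket D (⟨x, J i x⟩ : EndBundle E M) X) := by
      simp only [vertPart, christoffelBracket, ← hg0, hb, ha, smul_add, Finset.sum_add_distrib,
        Finset.mul_sum, Finset.sum_mul, smul_sub, mul_smul_comm, smul_mul_assoc,
        Finset.sum_sub_distrib, add_assoc]
      rfl
    rw [key, h.fiberAt_eq hxU]
    refine add_mem (Submodule.sum_mem _ fun i _ => Submodule.smul_mem _ _ (hmemJ i))
      (Submodule.sum_mem _ fun i _ => Submodule.smul_mem _ _ ?_)
    rw [hθ x hxU X i]
    exact add_mem (neg_mem (Submodule.smul_mem _ _ (hmemJ _))) (Submodule.smul_mem _ _ (hmemJ _))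
  · have hsq : (fun t => g t * g t) =ᶠ[𝓝 0] fun _ => -1 := by
      filter_upwards [hbase, h0] with t ht ht0
      refine (endCoord_comp ht _ _).symm.trans ?_
      rw [comp_self_of_mem_twistorSpace (hZ t ht0), endCoord_neg, endCoord_id ht]
      rfl
    have h2 := hsq.deriv_eq
    rw [deriv_const, deriv_fun_mul hgd hgd, hg0] at h2
    have h3 := endAt_mul_self_of_mem_twistorSpace (hZ 0 hmem0)
    simp only [vertPart, christoffelBracket]
    generalize endAt (γ 0) = z at *
    generalize christoffel D (γ 0).1 X = G at *
    rw [← sub_eq_zero, sub_neg_eq_add]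
    -- The connection term contributes [G, z]z + z[G, z] = [G, z²], which vanishes as z² = -1.
    calc _ = (deriv g 0 * z + z * deriv g 0) + (G * (z * z) - (z * z) * G) := by noncomm_ring
      _ = 0 := by rw [h2, h3]; simp

end

/-! ### The algebraic identity p[s(X), p] = [s(pX), p]. -/

namespace IsQuatTriple

section

variable {R : Type*} [Ring R] [Algebra ℝ R] {J : Fin 3 → R} (h : IsQuatTriple J)
include h

theorem sum_commutator_sum (a b : Fin 3 → ℝ) :
    (∑ i, a i • J i) * (∑ i, b i • J i) - (∑ i, b i • J i) * (∑ i, a i • J i) =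
      ∑ i, ![2 * (a 1 * b 2 - a 2 * b 1), 2 * (a 2 * b 0 - a 0 * b 2),
        2 * (a 0 * b 1 - a 1 * b 0)] i • J i := by
  rw [h.sum_mul_sum, h.sum_mul_sum, Fin.sum_univ_three]
  simp only [Matrix.cons_val]
  module

/-- The J₁-coefficients of the two sides are 2s¹ and 2t², and a quaternion triple is linearly
independent. -/
theorem eq_of_mul_commutator_eq [Nontrivial R] {s t : Fin 3 → ℝ}
    (hst : J 2 * ((∑ i, s i • J i) * J 2 - J 2 * (∑ i, s i • J i)) =
      (∑ i, t i • J i) * J 2 - J 2 * (∑ i, t i • J i)) : s 0 = t 1 := by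
  have h1 : ∑ i, ![2 * s 0 - 2 * t 1, 2 * s 1 + 2 * t 0, 0] i • J i = 0 := by
    rw [← sub_eq_zero] at hst
    rw [← hst]
    simp only [Fin.sum_univ_three, add_mul, mul_add, mul_sub, smul_mul_assoc, mul_smul_comm, h.sq,
      h.mul12, h.mul20, h.mul21, h.mul02, mul_neg, mul_one, smul_neg]
    simp only [Matrix.cons_val]
    module
  have h2 := (h.eq_zero_of_sum_eq_zero h1).1
  simp only [Matrix.cons_val] at h2
  linarith

end

variable {E : Type*} [NormedAddCommGroup E] [NormedSpace ℝ E] {J : Fin 3 → E →L[ℝ] E}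
  (h : IsQuatTriple J)
include h

theorem apply_apply_self (i : Fin 3) (X : E) : J i (J i X) = -X :=
  congrArg (fun T : E →L[ℝ] E => T X) (h.sq i)

/-- Applying the hypothesis also to the JₐX expresses all nine numbers sⁱ(JⱼX) through the sⁱ(X) and
s³(J₃X); both sides then have equal coefficients. No normalization of a is needed. -/
theorem mul_commutator_eq {s : Fin 3 → E →L[ℝ] ℝ}
    (hs : ∀ X, s 0 (J 0 X) = s 1 (J 1 X) ∧ s 1 (J 1 X) = s 2 (J 2 X)) (a : Fin 3 → ℝ) (X : E) :
    (∑ i, a i • J i) * ((∑ i, s i X • J i) * (∑ i, a i • J i) -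
        (∑ i, a i • J i) * (∑ i, s i X • J i)) =
      (∑ i, s i ((∑ i, a i • J i) X) • J i) * (∑ i, a i • J i) -
        (∑ i, a i • J i) * (∑ i, s i ((∑ i, a i • J i) X) • J i) := by
  have e0 : J 0 (J 0 X) = -X := h.apply_apply_self 0 X
  have e1 : J 1 (J 1 X) = -X := h.apply_apply_self 1 X
  have e2 : J 2 (J 2 X) = -X := h.apply_apply_self 2 X
  have e01 : J 0 (J 1 X) = J 2 X := congrArg (fun T : E →L[ℝ] E => T X) h.mul01
  have e10 : J 1 (J 0 X) = -J 2 X := congrArg (fun T : E →L[ℝ] E => T X) h.mul10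
  have e12 : J 1 (J 2 X) = J 0 X := congrArg (fun T : E →L[ℝ] E => T X) h.mul12
  have e21 : J 2 (J 1 X) = -J 0 X := congrArg (fun T : E →L[ℝ] E => T X) h.mul21
  have e20 : J 2 (J 0 X) = J 1 X := congrArg (fun T : E →L[ℝ] E => T X) h.mul20
  have e02 : J 0 (J 2 X) = -J 1 X := congrArg (fun T : E →L[ℝ] E => T X) h.mul02
  obtain ⟨k1, k2⟩ := hs X
  obtain ⟨k3, k4⟩ := hs (J 0 X)
  obtain ⟨k5, k6⟩ := hs (J 1 X)
  obtain ⟨k7, k8⟩ := hs (J 2 X)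
  simp only [e0, e1, e2, e01, e10, e12, e21, e20, e02, map_neg, neg_inj] at k3 k4 k5 k6 k7 k8
  have hz : ∀ i, s i ((∑ i, a i • J i) X) =
      a 0 * s i (J 0 X) + a 1 * s i (J 1 X) + a 2 * s i (J 2 X) := by
    intro i
    simp [Fin.sum_univ_three]
  rw [h.sum_commutator_sum, h.sum_commutator_sum, h.sum_mul_sum, Fin.sum_univ_three]
  have k9 : s 0 (J 1 X) = s 2 X := by linarith
  simp only [hz, Matrix.cons_val, k1, k2, k3, ← k4, k5, ← k6, k8, k9]
  module

end IsQuatTriple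

/-! ### The difference tensor and the comparison of the two structures. -/

section

variable {E : Type*} [NormedAddCommGroup E] [NormedSpace ℝ E] [FiniteDimensional ℝ E]
  {M : Type*} [TopologicalSpace M] [ChartedSpace E M] [IsManifold 𝓘(ℝ, E) ∞ M] {n : ℕ}
  {Q : AlmostQuaternionicStructure E M} {U : Set M} {J : Fin 3 → ∀ x : M, EndFiber E M x}

/-- All of TZ lies in the domain of the graph: pulled back by u, the vertical part is an element of
sp(1) anticommuting with J⁰₃, hence a commutator [A, J⁰₃] with A ∈ m₃. -/
theorem I1_apply [Nontrivial E] {D : LinearConnection E M} (hD : IsQuaternionic Q D)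
    {W : TangentBundle (endModel E) (EndBundle E M)} (hW : W ∈ tangentTwistorSpace n Q) :
    I1 n Q D W = ⟨W.1, twist D W.1 W.2⟩ := by
  obtain ⟨⟨u, hu, hp⟩, hK, hanti⟩ := vertPart_mem_and_anticomm hD hW
  obtain ⟨p, V⟩ := W
  obtain rfl : jMap n u = p := hp
  have hinv : (frameAt u).IsInvertible := hu.1
  obtain ⟨B, hB, hBK⟩ : ∃ B ∈ sp1 n,
      frameAt u ∘L B ∘L (frameAt u).inverse = vertPart D (jMap n u) V := by
    have h1 : vertPart D (jMap n u) V ∈ (Q.fiber u.1 : Set (EndFiber E M u.1)) := hK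
    rw [hu.2] at h1
    exact h1
  have hB2 : B * J0 n 2 = -(J0 n 2 * B) := by
    ext1 v
    have h1 := congrArg (fun T : E →L[ℝ] E => (frameAt u).inverse (T (frameAt u v))) hanti
    dsimp only at h1
    rw [← hBK, endAt_jMap] at h1
    simpa only [ContinuousLinearMap.mul_def, ContinuousLinearMap.comp_apply, neg_apply, map_neg,
      hinv.inverse_apply_self] using h1
  obtain ⟨A, hA, hA2, hAB⟩ := (isQuatTriple_J0 n).exists_commutator_eq hB hB2
  have hAm : A ∈ m3 n := ⟨Submodule.mem_sup_right hA, hA2⟩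
  exact I1_eq_twist (I1Graph_twist D hu hAm (by rw [hAB, hBK]))

/-- The difference tensor `S_X = ∇'_X - ∇_X`. -/
def differenceTensor (D D' : LinearConnection E M) (x : M) : E →L[ℝ] E →L[ℝ] E :=
  christoffel D' x - christoffel D x

theorem twist_eq_twist_iff (D D' : LinearConnection E M) (p : EndBundle E M)
    (W : E × (E →L[ℝ] E)) :
    twist D p W = twist D' p W ↔
      endAt p * (differenceTensor D D' p.1 W.1 * endAt p -
          endAt p * differenceTensor D D' p.1 W.1) =
        differenceTensor D D' p.1 (endAt p W.1) * endAt p -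
          endAt p * differenceTensor D D' p.1 (endAt p W.1) := by
  simp only [twist, Prod.mk.injEq, true_and, vertPart, christoffelBracket, differenceTensor,
    sub_apply]
  rw [← sub_eq_zero, ← neg_eq_zero, ← sub_eq_zero (a := endAt p * _)]
  refine Eq.congr ?_ rfl
  noncomm_ring

theorem IsQuaternionic.exists_isSp1Components {D D' : LinearConnection E M}
    (hD : IsQuaternionic Q D) (hD' : IsQuaternionic Q D') (h : IsAdmissibleBasis Q.fiber U J) :
    ∃ s : Fin 3 → ∀ x : M, TangentSpace 𝓘(ℝ, E) x →L[ℝ] ℝ, IsSp1Components D D' U J s := by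
  obtain ⟨θ, hθ⟩ := hD.exists_oneForms h
  obtain ⟨θ', hθ'⟩ := hD'.exists_oneForms h
  -- Subtracting the two formulas for the derivative of Jₐ gives [S_X, Jₐ] in terms of θ' - θ, while
  -- [Σ sᵇJ_b, Jₐ] has the same shape with coefficients 2sᵇ; hence the factor ½.
  refine ⟨fun a x => (2⁻¹ : ℝ) • (θ' a x - θ a x), fun x hx => ?_⟩
  have hq := h.isQuatTriple hx
  let s : Fin 3 → E →L[ℝ] ℝ := fun a => (2⁻¹ : ℝ) • (θ' a x - θ a x)
  let S0 : E →L[ℝ] E →L[ℝ] E := differenceTensor D D' x -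
    ∑ a, (s a).smulRight (tripleAt J x a)
  have hS0 : ∀ X, S0 X = differenceTensor D D' x X - ∑ a, s a X • tripleAt J x a := by
    intro X
    simp [S0]
  refine ⟨S0, fun X a => ?_, fun X Y => ?_⟩
  · have h1 : differenceTensor D D' x X * tripleAt J x a -
        tripleAt J x a * differenceTensor D D' x X =
        -((2 * s (a + 1) X) • tripleAt J x (a + 2)) +
          (2 * s (a + 2) X) • tripleAt J x (a + 1) := by
      have h2 := congrArg₂ (fun A B : E →L[ℝ] E => A - B) (hθ' x hx X a) (hθ x hx X a)
      have hs : ∀ b, 2 * s b X = θ' b x X - θ b x X := by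
        intro b
        change 2 * ((2⁻¹ : ℝ) * (θ' b x X - θ b x X)) = _
        ring
      rw [hs, hs]
      have h3 : ∀ D : LinearConnection E M, christoffelBracket D (⟨x, J a x⟩ : EndBundle E M) X =
          christoffel D x X * tripleAt J x a - tripleAt J x a * christoffel D x X := fun _ => rfl
      simp only [h3] at h2
      have h4 : differenceTensor D D' x X = christoffel D' x X - christoffel D x X := rfl
      rw [h4]
      refine Eq.trans ?_ (h2.trans ?_)
      · noncomm_ring
      · module
    change S0 X * tripleAt J x a = tripleAt J x a * S0 X
    refine sub_eq_zero.1 ?_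
    have h0 : (S0 X : E →L[ℝ] E) = differenceTensor D D' x X - ∑ a, s a X • tripleAt J x a := hS0 X
    refine (congrArg (fun A : E →L[ℝ] E => A * tripleAt J x a - tripleAt J x a * A) h0).trans ?_
    have h5 : (∑ b, s b X • tripleAt J x b) * tripleAt J x a -
        tripleAt J x a * (∑ b, s b X • tripleAt J x b) =
        -((2 * s (a + 1) X) • tripleAt J x (a + 2)) +
          (2 * s (a + 2) X) • tripleAt J x (a + 1) := by
      fin_cases a <;>
      · simp [Fin.sum_univ_three, add_mul, mul_add, hq.sq, hq.mul01, hq.mul10, hq.mul12, hq.mul20,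
          hq.mul21, hq.mul02]
        module
    calc _ = (differenceTensor D D' x X * tripleAt J x a -
        tripleAt J x a * differenceTensor D D' x X) -
        ((∑ b, s b X • tripleAt J x b) * tripleAt J x a -
        tripleAt J x a * (∑ b, s b X • tripleAt J x b)) := by noncomm_ring
      _ = 0 := by rw [h1, h5, sub_self]
  · refine (difference_eq_christoffel_sub D D' x Y X).trans ?_
    change differenceTensor D D' x X Y = S0 X Y + ∑ a, s a X • tripleAt J x a Y
    have h0 : ∀ X Y : E, differenceTensor D D' x X Y =
        S0 X Y + ∑ a, s a X • tripleAt J x a Y := by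
      intro X Y
      rw [hS0]
      simp
    exact h0 X Y

theorem IsSp1Components.commutator_eq {D D' : LinearConnection E M}
    {s : Fin 3 → ∀ x : M, TangentSpace 𝓘(ℝ, E) x →L[ℝ] ℝ} (hs : IsSp1Components D D' U J s)
    {x : M} (hx : x ∈ U) (a : Fin 3 → ℝ) (X : E) :
    differenceTensor D D' x X * (∑ i, a i • tripleAt J x i) -
        (∑ i, a i • tripleAt J x i) * differenceTensor D D' x X =
      (∑ i, s i x X • tripleAt J x i) * (∑ i, a i • tripleAt J x i) -
        (∑ i, a i • tripleAt J x i) * (∑ i, s i x X • tripleAt J x i) := by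
  obtain ⟨S0, hS0, hS⟩ := hs x hx
  let T : E →L[ℝ] E := S0 X
  have hT : ∀ i, T * tripleAt J x i = tripleAt J x i * T := fun i => hS0 X i
  have hTa : T * (∑ i, a i • tripleAt J x i) = (∑ i, a i • tripleAt J x i) * T := by
    simp only [Finset.mul_sum, Finset.sum_mul, mul_smul_comm, smul_mul_assoc, hT]
  have hd : differenceTensor D D' x X = T + ∑ i, s i x X • tripleAt J x i := by
    ext Y
    refine (difference_eq_christoffel_sub D D' x Y X).symm.trans ((hS X Y).trans ?_)
    simp only [add_apply, sum_apply, smul_apply]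
    rfl
  rw [hd, add_mul, mul_add, hTa]
  abel

omit [FiniteDimensional ℝ E] in
theorem exists_curve_mfderiv_eq {V : Set M} (hV : IsOpen V) {x : M} (hx : x ∈ V) (X : E) :
    ∃ (c : ℝ → M) (ε : ℝ), 0 < ε ∧ ContMDiffOn 𝓘(ℝ, ℝ) 𝓘(ℝ, E) ∞ c (Ioo (-ε) ε) ∧
      (∀ t ∈ Ioo (-ε) ε, c t ∈ V) ∧ c 0 = x ∧
      (mfderiv 𝓘(ℝ, ℝ) 𝓘(ℝ, E) c 0 (1 : ℝ) : E) = X := by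
  let φ := extChartAt 𝓘(ℝ, E) x
  let l : ℝ → E := fun t => φ x + t • X
  have hl0 : l 0 = φ x := by simp [l]
  have hl : ContMDiff 𝓘(ℝ, ℝ) 𝓘(ℝ, E) ∞ l :=
    contMDiff_iff_contDiff.2 (contDiff_const.add (contDiff_id.smul contDiff_const))
  have hφ : ContMDiffOn 𝓘(ℝ, E) 𝓘(ℝ, E) ∞ φ.symm φ.target := contMDiffOn_extChartAt_symm x
  have hopen : IsOpen (l ⁻¹' φ.target) :=
    (isOpen_extChartAt_target (I := 𝓘(ℝ, E)) x).preimage hl.continuous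
  have hc : ContMDiffOn 𝓘(ℝ, ℝ) 𝓘(ℝ, E) ∞ (fun t => φ.symm (l t)) (l ⁻¹' φ.target) :=
    hφ.comp hl.contMDiffOn (fun t ht => ht)
  have h0 : (0 : ℝ) ∈ l ⁻¹' φ.target := by
    change l 0 ∈ φ.target
    rw [hl0]
    exact mem_extChartAt_target x
  have hc0 : φ.symm (l 0) = x := by rw [hl0]; exact extChartAt_to_inv x
  have hnhds : (l ⁻¹' φ.target) ∩ (fun t => φ.symm (l t)) ⁻¹' V ∈ 𝓝 (0 : ℝ) := by
    refine Filter.inter_mem (hopen.mem_nhds h0) ?_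
    refine ((hc.continuousOn).continuousAt (hopen.mem_nhds h0)).preimage_mem_nhds ?_
    rw [hc0]
    exact hV.mem_nhds hx
  obtain ⟨ε, hε, hsub⟩ := Metric.mem_nhds_iff.1 hnhds
  rw [Real.ball_eq_Ioo, zero_sub, zero_add] at hsub
  refine ⟨fun t => φ.symm (l t), ε, hε, hc.mono fun t ht => (hsub ht).1,
    fun t ht => (hsub ht).2, hc0, ?_⟩
  have hcd : MDifferentiableAt 𝓘(ℝ, ℝ) 𝓘(ℝ, E) (fun t => φ.symm (l t)) 0 :=
    (hc.contMDiffAt (hopen.mem_nhds h0)).mdifferentiableAt (by simp)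
  have hφd : MDifferentiableAt 𝓘(ℝ, E) 𝓘(ℝ, E) φ (φ.symm (l 0)) := by
    rw [hc0]
    exact mdifferentiableAt_extChartAt (mem_chart_source E x)
  have h1 := mfderiv_comp_apply (0 : ℝ) hφd hcd (1 : ℝ)
  have h2 : φ ∘ (fun t => φ.symm (l t)) =ᶠ[𝓝 0] l := by
    filter_upwards [hopen.mem_nhds h0] with t ht
    exact φ.right_inv ht
  have h3 : mfderiv 𝓘(ℝ, ℝ) 𝓘(ℝ, E) (φ ∘ fun t => φ.symm (l t)) 0 (1 : ℝ) = X := by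
    have h4 : HasDerivAt l X 0 := by
      have h := ((hasDerivAt_id (0 : ℝ)).smul_const X).const_add (φ x)
      rwa [one_smul] at h
    have h5 : (mfderiv 𝓘(ℝ, ℝ) 𝓘(ℝ, E) (φ ∘ fun t => φ.symm (l t)) 0 : ℝ →L[ℝ] E) =
        fderiv ℝ l 0 := h2.mfderiv_eq.trans mfderiv_eq_fderiv
    refine (congrArg (fun T : ℝ →L[ℝ] E => T 1) h5).trans ?_
    exact h4.deriv
  have h6 : (mfderiv 𝓘(ℝ, E) 𝓘(ℝ, E) φ (φ.symm (l 0)) : E →L[ℝ] E) =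
      ContinuousLinearMap.id ℝ E := by
    rw [hc0]
    exact mfderiv_extChartAt_self (I := 𝓘(ℝ, E)) (x := x)
  exact (congrArg (fun T : E →L[ℝ] E =>
    T (mfderiv 𝓘(ℝ, ℝ) 𝓘(ℝ, E) (fun t => φ.symm (l t)) 0 (1 : ℝ))) h6).symm.trans
      (h1.symm.trans h3)

/-- The local section J₃ of Z, composed with a curve in M of velocity X, gives a tangent vector of Z
at J₃ over X. -/
theorem IsAdmissibleBasis.exists_mem_tangentTwistorSpace (hE : Module.finrank ℝ E = 4 * n)
    (h : IsAdmissibleBasis Q.fiber U J) {x : M} (hx : x ∈ U) (X : E) :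
    ∃ W ∈ tangentTwistorSpace n Q, W.1 = (⟨x, J 2 x⟩ : EndBundle E M) ∧
      (W.2 : E × (E →L[ℝ] E)).1 = X := by
  obtain ⟨c, ε, hε, hc, hcU, hc0, hcX⟩ := exists_curve_mfderiv_eq h.isOpen hx X
  let γ : ℝ → EndBundle E M := fun t => ⟨c t, J 2 (c t)⟩
  have hγ : ContMDiffOn 𝓘(ℝ, ℝ) (endModel E) ∞ γ (Ioo (-ε) ε) := (h.smooth 2).comp hc hcU
  have h0 : Ioo (-ε) ε ∈ 𝓝 (0 : ℝ) := Ioo_mem_nhds (neg_lt_zero.2 hε) hε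
  have hγd : MDifferentiableAt 𝓘(ℝ, ℝ) (endModel E) γ 0 :=
    (hγ.contMDiffAt h0).mdifferentiableAt (by simp)
  refine ⟨tangentMap 𝓘(ℝ, ℝ) (endModel E) γ ⟨0, (1 : ℝ)⟩,
    ⟨γ, ε, hε, hγ, fun t ht => h.exists_quatFrame hE (hcU t ht), rfl⟩,
    congrArg (fun y => (⟨y, J 2 y⟩ : EndBundle E M)) hc0, ?_⟩
  exact (congrArg Prod.fst (mfderiv_totalSpace_apply hγd (1 : ℝ))).trans hcX

omit [FiniteDimensional ℝ E] in
theorem IsAdmissibleBasis.rotate (h : IsAdmissibleBasis Q.fiber U J) :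
    IsAdmissibleBasis Q.fiber U (fun a => J (a + 1)) where
  isOpen := h.isOpen
  smooth a := h.smooth (a + 1)
  sq x hx a := h.sq x hx (a + 1)
  mul x hx := (h.isQuatTriple hx).rotate.mul01
  mul_rev x hx := (h.isQuatTriple hx).rotate.mul10
  span x hx := by
    rw [h.span x hx]
    congr 1
    exact ((Equiv.addRight (1 : Fin 3)).surjective.range_comp (fun a => J a x)).symm

theorem IsSp1Components.rotate {D D' : LinearConnection E M}
    {s : Fin 3 → ∀ x : M, TangentSpace 𝓘(ℝ, E) x →L[ℝ] ℝ} (hs : IsSp1Components D D' U J s) :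
    IsSp1Components D D' U (fun a => J (a + 1)) (fun a => s (a + 1)) := by
  intro x hx
  obtain ⟨S0, h1, h2⟩ := hs x hx
  refine ⟨S0, fun X a => h1 X (a + 1), fun X Y => (h2 X Y).trans ?_⟩
  congr 1
  exact (Equiv.sum_comp (Equiv.addRight (1 : Fin 3)) (fun a => s a x X • J a x Y)).symm

theorem sp1Components_eq_of_eqOn [Nontrivial E] (hE : Module.finrank ℝ E = 4 * n)
    {D D' : LinearConnection E M} (hD : IsQuaternionic Q D) (hD' : IsQuaternionic Q D')
    (heq : EqOn (I1 n Q D) (I1 n Q D') (tangentTwistorSpace n Q))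
    {s : Fin 3 → ∀ x : M, TangentSpace 𝓘(ℝ, E) x →L[ℝ] ℝ}
    (h : IsAdmissibleBasis Q.fiber U J) (hs : IsSp1Components D D' U J s) {x : M} (hx : x ∈ U)
    (X : TangentSpace 𝓘(ℝ, E) x) : s 0 x (J 0 x X) = s 1 x (J 1 x X) := by
  have hq := h.isQuatTriple hx
  -- At p = J₃ the criterion yields s¹(Y) = s²(J₃Y); the choice Y = J₁X turns J₃Y into J₂X.
  obtain ⟨W, hW, hW1, hW2⟩ := h.exists_mem_tangentTwistorSpace hE hx (tripleAt J x 0 X)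
  have h1 := heq hW
  rw [I1_apply hD hW, I1_apply hD' hW] at h1
  obtain ⟨p, V⟩ := W
  obtain rfl : p = (⟨x, J 2 x⟩ : EndBundle E M) := hW1
  have h2 : twist D (⟨x, J 2 x⟩ : EndBundle E M) V = twist D' (⟨x, J 2 x⟩ : EndBundle E M) V :=
    congrArg (fun W : TangentBundle (endModel E) (EndBundle E M) => (W.2 : E × (E →L[ℝ] E))) h1
  have h3 := (twist_eq_twist_iff D D' (⟨x, J 2 x⟩ : EndBundle E M) V).1 h2
  have hV : (V : E × (E →L[ℝ] E)).1 = tripleAt J x 0 X := hW2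
  generalize (V : E × (E →L[ℝ] E)).1 = Y at h3 hV
  subst hV
  have h2' : tripleAt J x 2 * (differenceTensor D D' x (tripleAt J x 0 X) * tripleAt J x 2 -
        tripleAt J x 2 * differenceTensor D D' x (tripleAt J x 0 X)) =
      differenceTensor D D' x (tripleAt J x 2 (tripleAt J x 0 X)) * tripleAt J x 2 -
        tripleAt J x 2 * differenceTensor D D' x (tripleAt J x 2 (tripleAt J x 0 X)) := h3
  have hc := hs.commutator_eq hx ![0, 0, 1]
  have h20 : tripleAt J x 2 (tripleAt J x 0 X) = tripleAt J x 1 X :=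
    congrArg (fun T : E →L[ℝ] E => T X) hq.mul20
  have hsum : ∑ i, (![0, 0, 1] : Fin 3 → ℝ) i • tripleAt J x i = tripleAt J x 2 := by
    simp [Fin.sum_univ_three]
  simp only [hsum] at hc
  rw [hc, hc, h20] at h2'
  exact hq.eq_of_mul_commutator_eq h2'

theorem eqOn_I1_of_sp1Components [Nontrivial E]
    {D D' : LinearConnection E M} (hD : IsQuaternionic Q D) (hD' : IsQuaternionic Q D')
    (hcond : ∀ (U : Set M) (J : Fin 3 → ∀ x : M, EndFiber E M x)
        (s : Fin 3 → ∀ x : M, TangentSpace 𝓘(ℝ, E) x →L[ℝ] ℝ),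
        IsAdmissibleBasis Q.fiber U J → IsSp1Components D D' U J s →
          ∀ x ∈ U, ∀ X : TangentSpace 𝓘(ℝ, E) x,
            s 0 x (J 0 x X) = s 1 x (J 1 x X) ∧ s 1 x (J 1 x X) = s 2 x (J 2 x X)) :
    EqOn (I1 n Q D) (I1 n Q D') (tangentTwistorSpace n Q) := by
  intro W hW
  rw [I1_apply hD hW, I1_apply hD' hW]
  refine congrArg (TotalSpace.mk W.1) ?_
  refine (twist_eq_twist_iff D D' W.1 W.2).2 ?_
  obtain ⟨U, J, hxU, h⟩ := Q.exists_basis W.1.1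
  obtain ⟨s, hs⟩ := hD.exists_isSp1Components hD' h
  have hz := mem_fiberAt_of_mem_twistorSpace (vertPart_mem_and_anticomm hD hW).1
  rw [h.fiberAt_eq hxU, Submodule.mem_span_range_iff_exists_fun] at hz
  obtain ⟨a, ha⟩ := hz
  rw [← ha, hs.commutator_eq hxU, hs.commutator_eq hxU]
  exact (h.isQuatTriple hxU).mul_commutator_eq (s := fun i => s i W.1.1)
    (fun X => hcond U J s h hs W.1.1 hxU X) a _

end

end Twistor

end

theorem propositiont2p5 {n : ℕ} (hn : 0 < n)
    {E : Type*} [NormedAddCommGroup E] [NormedSpace ℝ E] [FiniteDimensional ℝ E]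
    (hE : Module.finrank ℝ E = 4 * n)
    {M : Type*} [TopologicalSpace M] [T2Space M] [SecondCountableTopology M]
    [ChartedSpace E M] [IsManifold 𝓘(ℝ, E) ∞ M]
    (Q : Twistor.AlmostQuaternionicStructure E M) (D D' : Twistor.LinearConnection E M)
    (hD : Twistor.IsQuaternionic Q D) (hD' : Twistor.IsQuaternionic Q D') :
    (∀ (U : Set M) (J : Fin 3 → ∀ x : M, Twistor.EndFiber E M x),
      Twistor.IsAdmissibleBasis Q.fiber U J →
        ∃ s : Fin 3 → ∀ x : M, TangentSpace 𝓘(ℝ, E) x →L[ℝ] ℝ,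
          Twistor.IsSp1Components D D' U J s) ∧
    (Set.EqOn (Twistor.I1 n Q D) (Twistor.I1 n Q D') (Twistor.tangentTwistorSpace n Q) ↔
      ∀ (U : Set M) (J : Fin 3 → ∀ x : M, Twistor.EndFiber E M x)
        (s : Fin 3 → ∀ x : M, TangentSpace 𝓘(ℝ, E) x →L[ℝ] ℝ),
        Twistor.IsAdmissibleBasis Q.fiber U J → Twistor.IsSp1Components D D' U J s →
          ∀ x ∈ U, ∀ X : TangentSpace 𝓘(ℝ, E) x,
            s 0 x (J 0 x X) = s 1 x (J 1 x X) ∧ s 1 x (J 1 x X) = s 2 x (J 2 x X)) := by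
  -- Needed for the linear independence of the Jₐ and for dividing by dim E in the trace formula.
  have : Nontrivial E := Module.nontrivial_of_finrank_pos (R := ℝ) (by omega)
  refine ⟨fun U J h => hD.exists_isSp1Components hD' h, fun heq U J s h hs x hx X => ⟨?_, ?_⟩,
    Twistor.eqOn_I1_of_sp1Components hD hD'⟩
  · exact Twistor.sp1Components_eq_of_eqOn hE hD hD' heq h hs hx X
  -- The second equality is the first one for the admissible basis J₂, J₃, J₁.
  · exact Twistor.sp1Components_eq_of_eqOn hE hD hD' heq h.rotate hs.rotate hx X
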